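/- **Conventions.** Points of two-dimensional Minkowski space are $x=(x^0,x^1)$, and $W=\{x:|x^0|<x^1\}$ is the right wedge. For $m>0$ put $p_0=m\cosh\zeta$, $p_1=m\sinh\zeta$ (covariant components) and $px=p_0x^0+p_1x^1$. For a complex-valued Schwartz function $\hat f$ on $\mathbb R^2$ let $$f(\zeta)=\frac1{\sqrt{2\pi}}\int e^{-ip(\zeta)x}\hat f(x)\,d^2x ,$$ which is defined for $\zeta=\theta$ and $\zeta=\theta-i\pi$ with $\theta$ real; if $\hat f$ is real, then $f(\theta-i\pi)=\overline{f(\theta)}$. "$\operatorname{supp}\hat f\subset W$" means that $\hat f$ vanishes outside $W$. All operators are considered on the dense domain $D$ of vectors of finite particle number in the Fock space $\mathcal H$, and $\Omega$ is the vacuum. **(A) One self-conjugate particle.** Let $m>0$ and let $\vartheta:\mathbb R\to\mathbb R$ be a scattering phase, i.e. $e^{i\vartheta(\theta)}=S(\theta)$ for real $\theta$, where $S$ is continuous and bounded on the strip $0\le\operatorname{Im}\zeta\le\pi$, holomorphic in its interior, and satisfies $S(\theta)S(-\theta)=1$ and the crossing relation $S(\theta+i\pi)=S(-\theta)$ for real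 $\theta$. On the bosonic Fock space over $L^2(\mathbb R,d\theta)$, with annihilation operators $a(\theta)$, let $$Z(\theta)=a(\theta)\exp\Big(-i\int_{-\infty}^{\theta}\vartheta(\theta-\theta')\,a^*(\theta')a(\theta')\,d\theta'\Big),\qquad Z(x)=\frac1{\sqrt{2\pi}}\int\big(e^{-ipx}Z(\theta)+e^{ipx}Z^*(\theta)\big)d\theta ,$$ $$Z(\hat f)=\int Z(x)\hat f(x)\,d^2x=\int\big(f(\theta)Z(\theta)+f(\theta-i\pi)Z^*(\theta)\big)d\theta ,$$ and let $J=S_sJ_0$, where $J_0$ is complex conjugation of the rapidity wave functions and $S_s$ multiplies an $n$-particle wave function by $\prod_{\{i,j\}:\,\theta_i>\theta_j}S(\theta_i-\theta_j)$. Then $J$ and all $Z(\hat f)$ map $D$ into $D$, the Hermitian conjugate of $Z(\hat f)$ on $D$ is $Z(\overline{\hat f})$, and $Z$ is wedge-local: for $\operatorname{supp}\hat f,\operatorname{supp}\hat g\subset W$, $$[JZ(\hat f)J,\,Z(\hat g)]=0\ \text{ on } D,\qquad Z(\hat f)\Omega=\int f(\theta-i\pi)\,a^*(\theta)\,\Omega\,d\theta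 ,$$ the latter being a one-particle state, equal to $\int\overline{f(\theta)}\,a^*(\theta)\Omega\,d\theta$ if $\hat f$ is real. **(B) Federbush model.** Let $g\in\mathbb R$ and $m_I,m_{II}>0$. On the fermionic Fock space of two species $I,II$ of particles and antiparticles, with annihilation operators $a_I,a_{II}$ (particles) and $b_I,b_{II}$ (antiparticles) and charge densities $\rho_s=a_s^*a_s-b_s^*b_s$ in rapidity space, let $$c_I(\theta)=a_I(\theta)e^{-i\pi g\int_{-\infty}^\theta\rho_{II}},\quad d_I(\theta)=b_I(\theta)e^{i\pi g\int_{-\infty}^\theta\rho_{II}},\quad c_{II}(\theta)=a_{II}(\theta)e^{i\pi g\int_{-\infty}^\theta\rho_{I}},\quad d_{II}(\theta)=b_{II}(\theta)e^{-i\pi g\int_{-\infty}^\theta\rho_{I}},$$ $$Z_s(x)=\frac1{\sqrt{2\pi}}\int\big(e^{-ipx}c_s(\theta)+e^{ipx}d_s^*(\theta)\big)d\theta\qquad(s=I,II,\ \text{with mass } m_s),$$ so that $c_I(\theta_1)c_{II}(\theta_2)=-e^{i\pi g}c_{II}(\theta_2)c_I(\theta_1)$. Let $J=S_sJ_0$ with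 $$S_s=\exp\Big(i\pi g\iint\rho_I(\theta_1)\rho_{II}(\theta_2)\,\varepsilon(\theta_1-\theta_2)\,d\theta_1d\theta_2\Big),$$ $\varepsilon$ the sign function, and $J_0$ the antiunitary operator that conjugates the wave functions, exchanges particles and antiparticles, and reverses the order of the arguments (the factor $(-1)^{n(n-1)/2}$ of the Klein transformation). Then $J$ and all $Z_s(\hat f)$, $Z_s^*(\hat f)=\int Z_s(x)^*\hat f(x)\,d^2x$ map $D$ into $D$, $Z_s(\hat f)$ and $Z_s^*(\overline{\hat f})$ are Hermitian conjugate on $D$, and: 1. operators of different species commute directly in rapidity space: for $s\ne s'$ and $Z_s^\#\in\{c_s,d_s,c_s^*,d_s^*\}$, $$[JZ_s^\#(\theta)J,\,Z_{s'}^\#(\theta')]=0 ,$$ in the sense that the commutator vanishes on $D$ after smearing with arbitrary square-integrable functions of $\theta$ and $\theta'$; 2. for all $s,s'\in\{I,II\}$ and $\operatorname{supp}\hat f,\operatorname{supp}\hat h\subset W$, the operators $JZ_s(\hat f)J$ and $JZ_s^*(\hat f)J$ commute with $Z_{s'}(\hat h)$ and $Z_{s'}^*(\hat h)$ on $D$.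 -/

import Mathlib

open MeasureTheory
open scoped ComplexConjugate SchwartzMap

noncomputable section

namespace FWG

/-! ### Fock space: finite-particle vectors as sequences of square-integrable wave functions -/

/-- A sequence of `n`-particle wave functions; `X` is the space of one-particle labels. -/
abbrev Wave (X : Type) : Type := (n : ℕ) → (Fin n → X) → ℂ

inductive Statistics where
  | bose : Statistics
  | fermi : Statistics

/-- The character of the permutation group belonging to the statistics. -/
def Statistics.character : Statistics → (n : ℕ) → Equiv.Perm (Fin n) → ℂ
  | .bose, _, _ => 1
  | .fermi, _, p => ((Equiv.Perm.sign p : ℤ) : ℂ)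

/-- The sign picked up when a particle is moved past `k` others. -/
def Statistics.swapSign : Statistics → ℕ → ℂ
  | .bose, _ => 1
  | .fermi, k => (-1) ^ k

section Fock

variable {X : Type} [MeasurableSpace X]

/-- The `n`-fold product of the one-particle measure. -/
def nMeasure (μ : Measure X) (n : ℕ) : Measure (Fin n → X) := Measure.pi fun _ => μ

/-- Equality of Fock space vectors, i.e. of classes of wave functions modulo null sets. -/
def VecEq (μ : Measure X) (ψ χ : Wave X) : Prop :=
  ∀ n, ψ n =ᵐ[nMeasure μ n] χ n

/-- `ψ` represents a vector of finite particle number in the (anti)symmetric Fock space over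
`L²(X, μ)`. -/
structure FiniteParticle (σ : Statistics) (μ : Measure X) (ψ : Wave X) : Prop where
  memLp : ∀ n, MemLp (ψ n) 2 (nMeasure μ n)
  symm : ∀ (n : ℕ) (p : Equiv.Perm (Fin n)),
    ∀ᵐ η ∂(nMeasure μ n), ψ n (fun i => η (p i)) = σ.character n p * ψ n η
  finite : ∃ N : ℕ, ∀ n, N < n → ψ n =ᵐ[nMeasure μ n] 0

/-- The Fock space inner product, antilinear in the first argument. -/
def fockInner (μ : Measure X) (χ ψ : Wave X) : ℂ :=
  ∑' n, ∫ η, conj (χ n η) * ψ n η ∂(nMeasure μ n)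

/-- `A` is a well-defined operator from the finite-particle vectors to themselves. -/
def PreservesDomain (σ : Statistics) (μ : Measure X) (A : Wave X → Wave X) : Prop :=
  (∀ ψ, FiniteParticle σ μ ψ → FiniteParticle σ μ (A ψ)) ∧
  ∀ ψ χ, FiniteParticle σ μ ψ → FiniteParticle σ μ χ → VecEq μ ψ χ → VecEq μ (A ψ) (A χ)

/-- `B` is the Hermitian conjugate of `A` on finite-particle vectors. -/
def IsHermitianConj (σ : Statistics) (μ : Measure X) (A B : Wave X → Wave X) : Prop :=
  ∀ χ ψ, FiniteParticle σ μ χ → FiniteParticle σ μ ψ →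
    fockInner μ χ (A ψ) = fockInner μ (B χ) ψ

/-- `[A, B] = 0` on finite-particle vectors. -/
def CommuteOnFinite (σ : Statistics) (μ : Measure X) (A B : Wave X → Wave X) : Prop :=
  ∀ ψ, FiniteParticle σ μ ψ → VecEq μ (A (B ψ)) (B (A ψ))

end Fock

section Operators

variable {X : Type}

/-- The vacuum vector `Ω`. -/
def vacuum : Wave X := fun n _ => if n = 0 then 1 else 0

/-- The annihilation operator `a(ξ)`. -/
def annihilate (ξ : X) (ψ : Wave X) : Wave X :=
  fun n η => (Real.sqrt (n + 1) : ℂ) * ψ (n + 1) (Fin.cons ξ η)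

/-- `exp (i ∫ v(ξ') a*(ξ') a(ξ') dξ')` -/
def expDensity (v : X → ℝ) (ψ : Wave X) : Wave X :=
  fun n η => Complex.exp (Complex.I * ((∑ j, v (η j) : ℝ) : ℂ)) * ψ n η

/-- `Z(ξ) = a(ξ) exp (-i ∫ u(ξ, ξ') a*(ξ') a(ξ') dξ')` -/
def zPoint (u : X → X → ℝ) (ξ : X) (ψ : Wave X) : Wave X :=
  annihilate ξ (expDensity (fun ξ' => -u ξ ξ') ψ)

/-- `∫ φ(ξ) Z(ξ) dμ(ξ)` -/
def zAnn [MeasurableSpace X] (μ : Measure X) (u : X → X → ℝ) (φ : X → ℂ) (ψ : Wave X) : Wave X :=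
  fun n η => ∫ ξ, φ ξ * zPoint u ξ ψ n η ∂μ

/-- `∫ φ(ξ) Z*(ξ) dμ(ξ)`, where `Z*(ξ) = exp (i ∫ u(ξ, ξ') a*(ξ') a(ξ') dξ') a*(ξ)` and
`(a*(ξ)ψ)ₙ(η) = n^(-1/2) ∑ₖ (±1)ᵏ δ(ξ - ηₖ) ψₙ₋₁(η without ηₖ)`. -/
def zCre (σ : Statistics) (u : X → X → ℝ) (φ : X → ℂ) (ψ : Wave X) : Wave X
  | 0, _ => 0
  | n + 1, η => (Real.sqrt (n + 1) : ℂ)⁻¹ *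
      ∑ k : Fin (n + 1), σ.swapSign k * φ (η k) *
        Complex.exp (Complex.I * ((∑ j, u (η k) (η j) : ℝ) : ℂ)) *
        ψ n (fun j => η (k.succAbove j))

/-- `Z#(φ)`, standing for `∫ φ Z` (`false`) or `∫ φ Z*` (`true`). -/
def zSharp [MeasurableSpace X] (σ : Statistics) (μ : Measure X) (u : X → X → ℝ) :
    Bool → (X → ℂ) → Wave X → Wave X
  | false, φ => zAnn μ u φ
  | true, φ => zCre σ u φ

/-- The smeared free creation operator `∫ φ(ξ) a*(ξ) dξ`. -/
def creation (σ : Statistics) (φ : X → ℂ) : Wave X → Wave X := zCre σ (fun _ _ => 0) φ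

/-- The free (incoming) modular conjugation: complex conjugation together with the charge
conjugation `c`, reversing the order of the particles. On symmetric functions the reversal does
nothing, on antisymmetric ones it gives the factor `(-1)^(n(n-1)/2)` of the Klein
transformation. -/
def freeJ (c : X → X) (ψ : Wave X) : Wave X :=
  fun n η => conj (ψ n (fun i => c (η i.rev)))

/-- The scattering operator with two-particle phases `w`: multiplication of the `n`-particle wave
function by `∏ exp (i w(ηᵢ, ηⱼ))` over all ordered pairs (the kernels below vanish for one of the
two orders, so that every pair is counted once). -/
def scattering (w : X → X → ℝ) (ψ : Wave X) : Wave X :=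
  fun n η => Complex.exp (Complex.I * ((∑ i, ∑ j, w (η i) (η j) : ℝ) : ℂ)) * ψ n η

/-- The interacting modular conjugation `J = S_s J₀`. -/
def modularJ (c : X → X) (w : X → X → ℝ) (ψ : Wave X) : Wave X :=
  scattering w (freeJ c ψ)

/-- `J A J` -/
def conjByJ (J A : Wave X → Wave X) (ψ : Wave X) : Wave X := J (A (J ψ))

end Operators

/-! ### Test functions -/

/-- The right wedge; points are `(x⁰, x¹)`. -/
def wedge : Set (ℝ × ℝ) := {x | |x.1| < x.2}

/-- `f(ζ) = (2π)^(-1/2) ∫ exp (-i p(ζ)x) f̂(x) d²x` with `p₀ = m cosh ζ`, `p₁ = m sinh ζ` and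
`px = p₀ x⁰ + p₁ x¹` (covariant components of `p`, contravariant ones of `x`). -/
def waveFn (m : ℝ) (f : ℝ × ℝ → ℂ) (ζ : ℂ) : ℂ :=
  ((Real.sqrt (2 * Real.pi))⁻¹ : ℂ) *
    ∫ x : ℝ × ℝ, Complex.exp (-Complex.I *
      (m * (Complex.cosh ζ * (x.1 : ℂ) + Complex.sinh ζ * (x.2 : ℂ)))) * f x

/-! ### One self-conjugate particle -/

/-- `S` is the two-particle S-matrix with scattering phase `ϑ`, without bound states: continuous
and bounded on the closed strip `0 ≤ Im ζ ≤ π`, holomorphic inside, unitary, Hermitian analytic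
and crossing symmetric. -/
structure IsTwoParticleS (ϑ : ℝ → ℝ) (S : ℂ → ℂ) : Prop where
  continuousOn : ContinuousOn S {ζ | 0 ≤ ζ.im ∧ ζ.im ≤ Real.pi}
  differentiableOn : DifferentiableOn ℂ S {ζ | 0 < ζ.im ∧ ζ.im < Real.pi}
  bounded : ∃ C : ℝ, ∀ ζ : ℂ, 0 ≤ ζ.im → ζ.im ≤ Real.pi → ‖S ζ‖ ≤ C
  phase : ∀ θ : ℝ, S θ = Complex.exp (Complex.I * ϑ θ)
  unitary : ∀ θ : ℝ, S θ * S (-θ) = 1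
  crossing : ∀ θ : ℝ, S (θ + Real.pi * Complex.I) = S (-θ)

/-- `ϑ(θ - θ')` for `θ' < θ`, and zero otherwise. -/
def phaseBelow (ϑ : ℝ → ℝ) (θ θ' : ℝ) : ℝ := if θ' < θ then ϑ (θ - θ') else 0

/-- `Z(f̂) = ∫ Z(x) f̂(x) d²x = ∫ (f(θ) Z(θ) + f(θ - iπ) Z*(θ)) dθ` with
`Z(θ) = a(θ) exp (-i ∫_{-∞}^θ ϑ(θ - θ') a*(θ') a(θ') dθ')`. -/
def scalarZ (m : ℝ) (ϑ : ℝ → ℝ) (f : ℝ × ℝ → ℂ) (ψ : Wave ℝ) : Wave ℝ :=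
  zAnn volume (phaseBelow ϑ) (fun θ => waveFn m f θ) ψ +
    zCre .bose (phaseBelow ϑ) (fun θ => waveFn m f (θ - Real.pi * Complex.I)) ψ

/-- `J = S_s J₀`, with `S_s` the product of `S(θᵢ - θⱼ)` over the pairs `θᵢ > θⱼ`. -/
def scalarJ (ϑ : ℝ → ℝ) : Wave ℝ → Wave ℝ := modularJ id (phaseBelow ϑ)

/-! ### The Federbush model -/

/-- Rapidity, species (`0` is I, `1` is II) and charge (`true` is a particle, `false` an
antiparticle). -/
abbrev FedLabel : Type := ℝ × Fin 2 × Bool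

def fedMeasure : Measure FedLabel := (volume : Measure ℝ).prod Measure.count

def charge (q : Bool) : ℝ := if q then 1 else -1

def fedConj (ξ : FedLabel) : FedLabel := (ξ.1, ξ.2.1, !ξ.2.2)

/-- The phases in the `Z`-operators: the annihilators for charge `q` are
`a_I(θ) exp (-iπgq ∫_{-∞}^θ ρ_II)` and `a_II(θ) exp (iπgq ∫_{-∞}^θ ρ_I)`, with `ρ` the charge
densities in rapidity space. -/
def fedKernel (g : ℝ) (ξ η : FedLabel) : ℝ :=
  if ξ.2.1 ≠ η.2.1 ∧ η.1 < ξ.1 then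
    (if ξ.2.1 = 0 then 1 else -1) * (Real.pi * g * charge ξ.2.2 * charge η.2.2)
  else 0

/-- The scattering phases: `S_s = exp (iπg ∫∫ ρ_I(θ₁) ρ_II(θ₂) ε(θ₁ - θ₂) dθ₁ dθ₂)`. -/
def fedScattering (g : ℝ) (ξ η : FedLabel) : ℝ :=
  if ξ.2.1 = 0 ∧ η.2.1 = 1 then
    Real.pi * g * charge ξ.2.2 * charge η.2.2 * Real.sign (ξ.1 - η.1)
  else 0

def fedJ (g : ℝ) : Wave FedLabel → Wave FedLabel := modularJ fedConj (fedScattering g)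

/-- The one-particle function `h` of species `s` and charge `q`. -/
def component (s : Fin 2) (q : Bool) (h : ℝ → ℂ) (ξ : FedLabel) : ℂ :=
  if ξ.2 = (s, q) then h ξ.1 else 0

/-- The field of species `s`, smeared: for `q = true` it is `Z_s(f̂)` with
`Z_s(x) = (2π)^(-1/2) ∫ (exp (-ipx) c_s(θ) + exp (ipx) d_s*(θ)) dθ`, for `q = false` it is the
conjugate field `Z_s*(f̂)`. -/
def fedZ (m : Fin 2 → ℝ) (g : ℝ) (s : Fin 2) (q : Bool) (f : ℝ × ℝ → ℂ) (ψ : Wave FedLabel) :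
    Wave FedLabel :=
  zAnn fedMeasure (fedKernel g) (component s q fun θ => waveFn (m s) f θ) ψ +
    zCre .fermi (fedKernel g)
      (component s (!q) fun θ => waveFn (m s) f (θ - Real.pi * Complex.I)) ψ

end FWG

end

open FWG

/-!
Conjugation by `J` turns a `Z`-operator into the one with transposed phases that acts from the
opposite end of the sequence of particles. Annihilators at the two ends commute, and so do
creators; a mixed commutator is, up to a sign, multiplication of `ψ n` by the contraction
`∫ φ ξ * χ ξ * ∏ⱼ exp (i (u (ηⱼ, ξ) - u (ξ, ηⱼ))) dξ`. For fields, locality is therefore the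
equality of two contractions. If the test functions are wedge-localized, the integrand extends
analytically to `0 ≤ Im ζ ≤ π` and decays at infinity; crossing, `S (θ + iπ) = S (-θ)`, identifies
its boundary value at `Im ζ = π` with the other contraction, so that shifting the contour proves
the equality. In the Federbush model the phases in the contraction do not depend on the rapidity.
-/

noncomputable section

namespace FWG

section SquareIntegrable

variable {X Y 𝕜 : Type*} [RCLike 𝕜] [MeasurableSpace X] [MeasurableSpace Y] {μ : Measure X}
  {ν : Measure Y}

lemma memLp_two_mul_prod {φ : X → 𝕜} {ψ : Y → 𝕜} (hφ : MemLp φ 2 μ)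
    (hψ : MemLp ψ 2 ν) : MemLp (fun z : X × Y => φ z.1 * ψ z.2) 2 (μ.prod ν) := by
  refine (memLp_two_iff_integrable_sq_norm (hφ.1.comp_fst.mul hψ.1.comp_snd)).2 ?_
  simpa only [Pi.mul_apply, norm_mul, mul_pow] using hφ.integrable_norm_pow two_ne_zero |>.mul_prod
    (hψ.integrable_norm_pow two_ne_zero)

lemma ae_memLp_two_slice [SFinite μ] [SFinite ν] {G : X × Y → 𝕜} (hG : MemLp G 2 (μ.prod ν)) :
    ∀ᵐ y ∂ν, MemLp (fun x => G (x, y)) 2 μ := by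
  have hG' := hG.comp_measurePreserving (Measure.measurePreserving_swap (μ := ν) (ν := μ))
  filter_upwards [(hG'.integrable_norm_pow two_ne_zero).prod_right_ae, hG'.1.prodMk_left]
    with y hint hmeas
  exact (memLp_two_iff_integrable_sq_norm hmeas).2 hint

lemma norm_integral_mul_sq_le {φ G : X → 𝕜} (hφ : MemLp φ 2 μ) (hG : MemLp G 2 μ) :
    ‖∫ x, φ x * G x ∂μ‖ ^ 2 ≤ (∫ x, ‖φ x‖ ^ 2 ∂μ) * ∫ x, ‖G x‖ ^ 2 ∂μ := by
  have sq_rpow_half : ∀ t : ℝ, 0 ≤ t → (t ^ (1 / 2 : ℝ)) ^ 2 = t := fun t ht => by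
    rw [← Real.sqrt_eq_rpow, Real.sq_sqrt ht]
  have holder := integral_mul_norm_le_Lp_mul_Lq (μ := μ) (f := φ) (g := G)
    Real.HolderConjugate.two_two (by simpa using hφ) (by simpa using hG)
  simp only [Real.rpow_two] at holder
  calc ‖∫ x, φ x * G x ∂μ‖ ^ 2 ≤ (∫ x, ‖φ x‖ * ‖G x‖ ∂μ) ^ 2 := by
        gcongr
        simpa only [norm_mul] using norm_integral_le_integral_norm fun x => φ x * G x
    _ ≤ _ := pow_le_pow_left₀ (by positivity) holder 2
    _ = _ := by
        rw [mul_pow, sq_rpow_half _ (by positivity), sq_rpow_half _ (by positivity)]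

lemma memLp_two_integral_mul [SFinite μ] [SFinite ν] {φ : X → 𝕜} {G : X × Y → 𝕜}
    (hφ : MemLp φ 2 μ) (hG : MemLp G 2 (μ.prod ν)) :
    MemLp (fun y => ∫ x, φ x * G (x, y) ∂μ) 2 ν := by
  have hG' := hG.comp_measurePreserving (Measure.measurePreserving_swap (μ := ν) (ν := μ))
  have hmeas : AEStronglyMeasurable (fun y => ∫ x, φ x * G (x, y) ∂μ) ν :=
    (hφ.1.comp_snd.mul hG'.1).integral_prod_right'
  rw [memLp_two_iff_integrable_sq_norm hmeas]
  refine ((hG'.integrable_norm_pow two_ne_zero).integral_prod_left.const_mul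
    (∫ x, ‖φ x‖ ^ 2 ∂μ)).mono' (hmeas.norm.pow 2) ?_
  filter_upwards [ae_memLp_two_slice hG] with y hy
  simpa using norm_integral_mul_sq_le hφ hy

end SquareIntegrable

section ParticleConfigurations

variable {X : Type} [MeasurableSpace X] {μ : Measure X} [SigmaFinite μ] {n : ℕ}

instance : SigmaFinite (nMeasure μ n) := by
  unfold nMeasure
  infer_instance

lemma measurePreserving_removeNth (k : Fin (n + 1)) :
    MeasurePreserving (fun η : Fin (n + 1) → X => (η k, k.removeNth η)) (nMeasure μ (n + 1))
      (μ.prod (nMeasure μ n)) :=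
  measurePreserving_piFinSuccAbove (fun _ => μ) k

lemma measurePreserving_insertNth (k : Fin (n + 1)) :
    MeasurePreserving (fun z : X × (Fin n → X) => (k.insertNth z.1 z.2 : Fin (n + 1) → X))
      (μ.prod (nMeasure μ n)) (nMeasure μ (n + 1)) :=
  (measurePreserving_removeNth k).symm (MeasurableEquiv.piFinSuccAbove (fun _ => X) k)

lemma measurePreserving_cons :
    MeasurePreserving (fun z : X × (Fin n → X) => (Fin.cons z.1 z.2 : Fin (n + 1) → X))
      (μ.prod (nMeasure μ n)) (nMeasure μ (n + 1)) := by
  simpa only [Fin.insertNth_zero'] using measurePreserving_insertNth (μ := μ) (n := n) 0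

lemma measurePreserving_snoc :
    MeasurePreserving (fun z : X × (Fin n → X) => (Fin.snoc z.2 z.1 : Fin (n + 1) → X))
      (μ.prod (nMeasure μ n)) (nMeasure μ (n + 1)) := by
  simpa only [Fin.insertNth_last'] using measurePreserving_insertNth (μ := μ) (Fin.last n)

lemma measurePreserving_comp_perm (p : Equiv.Perm (Fin n)) :
    MeasurePreserving (fun η : Fin n → X => fun i => η (p i)) (nMeasure μ n) (nMeasure μ n) :=
  measurePreserving_arrowCongr' (fun _ : Fin n => μ) (fun _ : Fin n => μ) p.symm
    (MeasurableEquiv.refl X) (fun _ => MeasurePreserving.id μ)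

lemma measurePreserving_comp_rev {c : X → X} (hc : MeasurePreserving c μ μ) :
    MeasurePreserving (fun η : Fin n → X => fun i => c (η i.rev)) (nMeasure μ n) (nMeasure μ n) :=
  (measurePreserving_pi _ _ fun _ => hc).comp (measurePreserving_comp_perm Fin.revPerm)

lemma ae_removeNth (k : Fin (n + 1)) {P : (Fin n → X) → Prop} (h : ∀ᵐ η ∂(nMeasure μ n), P η) :
    ∀ᵐ η ∂(nMeasure μ (n + 1)), P (k.removeNth η) :=
  (Measure.quasiMeasurePreserving_snd.comp
    (measurePreserving_removeNth (μ := μ) k).quasiMeasurePreserving).ae h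

lemma ae_ae_cons {P : (Fin (n + 1) → X) → Prop} (h : ∀ᵐ η ∂(nMeasure μ (n + 1)), P η) :
    ∀ᵐ η ∂(nMeasure μ n), ∀ᵐ ξ ∂μ, P (Fin.cons ξ η) :=
  Measure.ae_ae_of_ae_prod (Measure.measurePreserving_swap.quasiMeasurePreserving.ae
    (measurePreserving_cons.quasiMeasurePreserving.ae h))

end ParticleConfigurations

section Phases

variable {X Y : Type} [MeasurableSpace Y] {v v' : Y → ℝ} {n : ℕ} {u w : X → X → ℝ}

lemma exp_I_mul_ofReal (t : ℝ) : Complex.exp (Complex.I * (t : ℂ)) = Circle.exp t := by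
  rw [Circle.coe_exp, mul_comm]

lemma conj_circleExp (t : ℝ) : conj (Circle.exp t : ℂ) = Circle.exp (-t) := by
  rw [Circle.exp_neg, Circle.coe_inv_eq_conj]

lemma coe_circleExp_add (s t : ℝ) : (Circle.exp (s + t) : ℂ) = Circle.exp s * Circle.exp t := by
  rw [Circle.exp_add, Circle.coe_mul]

lemma measurable_circleExp_neg (hv : Measurable fun y => (Circle.exp (v y) : ℂ)) :
    Measurable fun y => (Circle.exp (-v y) : ℂ) := by
  simp only [Circle.exp_neg, Circle.coe_inv]
  exact hv.inv

lemma measurable_circleExp_add (hv : Measurable fun y => (Circle.exp (v y) : ℂ))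
    (hv' : Measurable fun y => (Circle.exp (v' y) : ℂ)) :
    Measurable fun y => (Circle.exp (v y + v' y) : ℂ) := by
  simp only [coe_circleExp_add]
  exact hv.mul hv'

lemma measurable_circleExp_sum {ι : Type*} (s : Finset ι) {v : ι → Y → ℝ}
    (hv : ∀ i, Measurable fun y => (Circle.exp (v i y) : ℂ)) :
    Measurable fun y => (Circle.exp (∑ i ∈ s, v i y) : ℂ) := by
  classical
  induction s using Finset.induction_on with
  | empty => simp
  | insert i s hi ih =>
    simpa only [Finset.sum_insert hi] using measurable_circleExp_add (hv i) ih

lemma memLp_circleExp_mul {μ : Measure Y} {p : ENNReal} {F : Y → ℂ} (hF : MemLp F p μ)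
    (hv : Measurable fun y => (Circle.exp (v y) : ℂ)) :
    MemLp (fun y => (Circle.exp (v y) : ℂ) * F y) p μ :=
  hF.of_le (hv.aestronglyMeasurable.mul hF.1) (.of_forall fun y => by simp)

/-- The phase `∑ⱼ u(ξ, ηⱼ)` that a particle `ξ` picks up from the configuration `η`. -/
def phaseSum (u : X → X → ℝ) (ξ : X) (η : Fin n → X) : ℝ := ∑ j, u ξ (η j)

/-- The phase `∑ᵢⱼ w(ηᵢ, ηⱼ)` of the scattering operator on the configuration `η`. -/
def totalPhase (w : X → X → ℝ) (η : Fin n → X) : ℝ := ∑ i, phaseSum w (η i) η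

lemma phaseSum_removeNth (ξ : X) (η : Fin (n + 1) → X) (k : Fin (n + 1)) :
    phaseSum u ξ η = u ξ (η k) + phaseSum u ξ (k.removeNth η) :=
  Fin.sum_univ_succAbove _ k

lemma phaseSum_insertNth (ξ ξ' : X) (η : Fin n → X) (k : Fin (n + 1)) :
    phaseSum u ξ (k.insertNth ξ' η : Fin (n + 1) → X) = u ξ ξ' + phaseSum u ξ η := by
  rw [phaseSum_removeNth _ _ k, Fin.insertNth_apply_same, Fin.removeNth_insertNth]

lemma phaseSum_cons (ξ ξ' : X) (η : Fin n → X) :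
    phaseSum u ξ (Fin.cons ξ' η : Fin (n + 1) → X) = u ξ ξ' + phaseSum u ξ η := by
  rw [← Fin.insertNth_zero', phaseSum_insertNth]

lemma phaseSum_snoc (ξ ξ' : X) (η : Fin n → X) :
    phaseSum u ξ (Fin.snoc η ξ' : Fin (n + 1) → X) = u ξ ξ' + phaseSum u ξ η := by
  rw [← Fin.insertNth_last', phaseSum_insertNth]

lemma phaseSum_comp_perm (ξ : X) (η : Fin n → X) (p : Equiv.Perm (Fin n)) :
    phaseSum u ξ (fun i => η (p i)) = phaseSum u ξ η :=
  Equiv.sum_comp p fun j => u ξ (η j)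

lemma phaseSum_comp_rev (ξ : X) (η : Fin n → X) :
    phaseSum u ξ (fun i => η i.rev) = phaseSum u ξ η :=
  phaseSum_comp_perm ξ η Fin.revPerm

lemma totalPhase_comp_perm (η : Fin n → X) (p : Equiv.Perm (Fin n)) :
    totalPhase w (fun i => η (p i)) = totalPhase w η := by
  simp only [totalPhase, phaseSum_comp_perm, Equiv.sum_comp p fun i => phaseSum w (η i) η]

lemma totalPhase_removeNth (η : Fin (n + 1) → X) (k : Fin (n + 1)) :
    totalPhase w η = w (η k) (η k) + ∑ j, (w (η k) (k.removeNth η j) + w (k.removeNth η j) (η k)) +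
      totalPhase w (k.removeNth η) := by
  simp only [totalPhase, phaseSum, Fin.removeNth, Fin.sum_univ_succAbove _ k,
    Finset.sum_add_distrib]
  ring

variable [MeasurableSpace X]

/-- Joint measurability of the phase factor `exp (i u(ξ, η))`. This is asked for instead of
measurability of `u`, since a scattering phase is determined by the S-matrix only modulo `2π`. -/
def MeasurablePhase (u : X → X → ℝ) : Prop :=
  Measurable fun z : X × X => (Circle.exp (u z.1 z.2) : ℂ)

lemma MeasurablePhase.comp (hu : MeasurablePhase u) {a b : Y → X} (ha : Measurable a)
    (hb : Measurable b) : Measurable fun y => (Circle.exp (u (a y) (b y)) : ℂ) :=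
  Measurable.comp (g := fun z : X × X => (Circle.exp (u z.1 z.2) : ℂ)) hu (ha.prodMk hb)

lemma MeasurablePhase.swap (hu : MeasurablePhase u) : MeasurablePhase (Function.swap u) :=
  hu.comp measurable_snd measurable_fst

lemma MeasurablePhase.phaseSum (hu : MeasurablePhase u) {a : Y → X} {b : Y → Fin n → X}
    (ha : Measurable a) (hb : Measurable b) :
    Measurable fun y => (Circle.exp (phaseSum u (a y) (b y)) : ℂ) :=
  measurable_circleExp_sum _ fun j => hu.comp ha (measurable_pi_iff.1 hb j)

lemma MeasurablePhase.totalPhase (hw : MeasurablePhase w) :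
    Measurable fun η : Fin n → X => (Circle.exp (totalPhase w η) : ℂ) :=
  measurable_circleExp_sum _ fun i => hw.phaseSum (measurable_pi_apply i) measurable_id

end Phases

section Components

variable {X : Type} {u w : X → X → ℝ} {φ : X → ℂ} {ψ χ : Wave X} {σ : Statistics} {n : ℕ}

lemma zPoint_apply (u : X → X → ℝ) (ξ : X) (ψ : Wave X) (η : Fin n → X) :
    zPoint u ξ ψ n η = (Real.sqrt (n + 1) : ℂ) *
      (Circle.exp (-phaseSum u ξ (Fin.cons ξ η : Fin (n + 1) → X)) * ψ (n + 1) (Fin.cons ξ η)) := by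
  simp only [zPoint, annihilate, expDensity, exp_I_mul_ofReal, Finset.sum_neg_distrib, phaseSum]

lemma zCre_succ (σ : Statistics) (u : X → X → ℝ) (φ : X → ℂ) (ψ : Wave X) (η : Fin (n + 1) → X) :
    zCre σ u φ ψ (n + 1) η = (Real.sqrt (n + 1) : ℂ)⁻¹ * ∑ k : Fin (n + 1),
      σ.swapSign k * φ (η k) * Circle.exp (phaseSum u (η k) η) * ψ n (k.removeNth η) := by
  simp only [zCre, exp_I_mul_ofReal]
  rfl

lemma modularJ_apply (c : X → X) (w : X → X → ℝ) (ψ : Wave X) (η : Fin n → X) :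
    modularJ c w ψ n η = Circle.exp (totalPhase w η) * conj (ψ n fun i => c (η i.rev)) := by
  simp only [modularJ, scattering, freeJ, exp_I_mul_ofReal]
  rfl

lemma zPoint_add (ξ : X) : zPoint u ξ (ψ + χ) = zPoint u ξ ψ + zPoint u ξ χ := by
  funext n η
  simp only [zPoint_apply, Pi.add_apply, mul_add]

lemma zCre_add : zCre σ u φ (ψ + χ) = zCre σ u φ ψ + zCre σ u φ χ := by
  funext n η
  cases n with
  | zero => simp only [zCre, Pi.add_apply, add_zero]
  | succ n => simp only [zCre_succ, Pi.add_apply, mul_add, Finset.sum_add_distrib]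

lemma modularJ_add (c : X → X) :
    modularJ c w (ψ + χ) = modularJ c w ψ + modularJ c w χ := by
  funext n η
  simp only [modularJ_apply, Pi.add_apply, map_add, mul_add]

lemma sqrt_succ_ne_zero (n : ℕ) : (Real.sqrt (n + 1) : ℂ) ≠ 0 := by
  rw [Complex.ofReal_ne_zero]
  positivity

end Components

/-! ### The domain of finite particle number -/

section SmearedOperators

variable {X : Type} [MeasurableSpace X] {μ : Measure X} {u w : X → X → ℝ}
  {φ φ' : X → ℂ} {ψ ψ' χ χ' : Wave X} {σ : Statistics} {c : X → X} {n : ℕ}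

/-- The general field `∫ φ Z + ∫ φ' Z*`. -/
def zField (σ : Statistics) (μ : Measure X) (u : X → X → ℝ) (φ φ' : X → ℂ) (ψ : Wave X) : Wave X :=
  zAnn μ u φ ψ + zCre σ u φ' ψ

/-- All components are square-integrable: a vector of the unsymmetrized Fock space, without any
bound on the total norm. -/
def SquareIntegrable (μ : Measure X) (ψ : Wave X) : Prop := ∀ n, MemLp (ψ n) 2 (nMeasure μ n)

lemma VecEq.add (h : VecEq μ ψ χ) (h' : VecEq μ ψ' χ') : VecEq μ (ψ + ψ') (χ + χ') :=
  fun n => (h n).add (h' n)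

variable [SigmaFinite μ]

lemma SquareIntegrable.zPoint (hu : MeasurablePhase u) (hψ : SquareIntegrable μ ψ) (n : ℕ) :
    MemLp (fun z : X × (Fin n → X) => zPoint u z.1 ψ n z.2) 2 (μ.prod (nMeasure μ n)) := by
  simp only [zPoint_apply]
  exact (memLp_circleExp_mul ((hψ (n + 1)).comp_measurePreserving measurePreserving_cons)
    (measurable_circleExp_neg (hu.phaseSum measurable_fst
      (measurePreserving_cons (μ := μ)).measurable))).const_mul _

lemma SquareIntegrable.ae_zPoint (hu : MeasurablePhase u) (hψ : SquareIntegrable μ ψ) (n : ℕ) :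
    ∀ᵐ η ∂(nMeasure μ n), MemLp (fun ξ => FWG.zPoint u ξ ψ n η) 2 μ :=
  ae_memLp_two_slice (hψ.zPoint hu n)

lemma SquareIntegrable.zAnn (hu : MeasurablePhase u) (hφ : MemLp φ 2 μ)
    (hψ : SquareIntegrable μ ψ) : SquareIntegrable μ (zAnn μ u φ ψ) :=
  fun n => memLp_two_integral_mul hφ (hψ.zPoint hu n)

lemma VecEq.ae_zPoint (h : VecEq μ ψ χ) (u : X → X → ℝ) (n : ℕ) :
    ∀ᵐ η ∂(nMeasure μ n), ∀ᵐ ξ ∂μ, zPoint u ξ ψ n η = zPoint u ξ χ n η := by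
  filter_upwards [ae_ae_cons (h (n + 1))] with η hη
  filter_upwards [hη] with ξ hξ
  rw [zPoint_apply, zPoint_apply, hξ]

lemma VecEq.zAnn (h : VecEq μ ψ χ) : VecEq μ (zAnn μ u φ ψ) (zAnn μ u φ χ) := by
  intro n
  filter_upwards [h.ae_zPoint u n] with η hη
  refine integral_congr_ae ?_
  filter_upwards [hη] with ξ hξ
  rw [hξ]

lemma zAnn_add (hu : MeasurablePhase u) (hφ : MemLp φ 2 μ) (hψ : SquareIntegrable μ ψ)
    (hχ : SquareIntegrable μ χ) :
    VecEq μ (zAnn μ u φ (ψ + χ)) (zAnn μ u φ ψ + zAnn μ u φ χ) := by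
  intro n
  filter_upwards [hψ.ae_zPoint hu n, hχ.ae_zPoint hu n] with η hψη hχη
  simp only [zAnn, Pi.add_apply, zPoint_add, mul_add]
  exact integral_add (hφ.integrable_mul hψη) (hφ.integrable_mul hχη)

lemma SquareIntegrable.zCre_term (hu : MeasurablePhase u) (hφ : MemLp φ 2 μ)
    (hψ : SquareIntegrable μ ψ) (a : ℂ) (k : Fin (n + 1)) :
    MemLp (fun η : Fin (n + 1) → X => a * φ (η k) *
      Circle.exp (phaseSum u (η k) η) * ψ n (k.removeNth η)) 2 (nMeasure μ (n + 1)) := by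
  have hprod := (memLp_two_mul_prod hφ (hψ n)).comp_measurePreserving
    (measurePreserving_removeNth k)
  refine ((memLp_circleExp_mul hprod
    (hu.phaseSum (measurable_pi_apply k) measurable_id)).const_mul a).ae_eq (.of_forall fun η => ?_)
  simp only [Function.comp, id]
  ring

lemma SquareIntegrable.zCre (hu : MeasurablePhase u) (hφ : MemLp φ 2 μ)
    (hψ : SquareIntegrable μ ψ) : SquareIntegrable μ (zCre σ u φ ψ)
  | 0 => MemLp.zero'
  | n + 1 => by
    refine ((memLp_finsetSum Finset.univ fun (k : Fin (n + 1)) _ =>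
      hψ.zCre_term hu hφ (σ.swapSign k) k).const_mul (Real.sqrt (n + 1) : ℂ)⁻¹).ae_eq
      (.of_forall fun η => ?_)
    rw [zCre_succ]

lemma zCre_succ_congr_ae (h : ψ n =ᵐ[nMeasure μ n] χ n) :
    zCre σ u φ ψ (n + 1) =ᵐ[nMeasure μ (n + 1)] zCre σ u φ χ (n + 1) := by
  filter_upwards [ae_all_iff.2 fun k => ae_removeNth k h] with η hη
  simp only [zCre_succ, hη]

lemma VecEq.zCre (h : VecEq μ ψ χ) : VecEq μ (zCre σ u φ ψ) (zCre σ u φ χ)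
  | 0 => .rfl
  | n + 1 => zCre_succ_congr_ae (h n)

lemma SquareIntegrable.modularJ (hc : MeasurePreserving c μ μ) (hw : MeasurablePhase w)
    (hψ : SquareIntegrable μ ψ) : SquareIntegrable μ (modularJ c w ψ) := by
  intro n
  refine (memLp_circleExp_mul ((hψ n).comp_measurePreserving (measurePreserving_comp_rev hc)).star
    hw.totalPhase).ae_eq (.of_forall fun η => ?_)
  rw [modularJ_apply]
  rfl

lemma VecEq.modularJ (hc : MeasurePreserving c μ μ) (h : VecEq μ ψ χ) :
    VecEq μ (modularJ c w ψ) (modularJ c w χ) := by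
  intro n
  filter_upwards [(measurePreserving_comp_rev hc).quasiMeasurePreserving.ae (h n)] with η hη
  rw [modularJ_apply, modularJ_apply, hη]

end SmearedOperators

section ExchangeSymmetry

variable {X : Type} {σ : Statistics} {n : ℕ}

lemma character_mul (p q : Equiv.Perm (Fin n)) :
    σ.character n (p * q) = σ.character n p * σ.character n q := by
  cases σ <;> simp [Statistics.character]

lemma character_cycleRange (k : Fin (n + 1)) :
    σ.character (n + 1) k.cycleRange = σ.swapSign k := by
  cases σ <;> simp [Statistics.character, Statistics.swapSign, Fin.sign_cycleRange]

lemma character_decomposeFin (e : Equiv.Perm (Fin n)) :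
    σ.character (n + 1) (Equiv.Perm.decomposeFin.symm (0, e)) = σ.character n e := by
  cases σ <;> simp [Statistics.character, Equiv.Perm.decomposeFin.symm_sign]

lemma conj_character (p : Equiv.Perm (Fin n)) : conj (σ.character n p) = σ.character n p := by
  cases σ <;> simp [Statistics.character]

lemma character_rev_conj (p : Equiv.Perm (Fin n)) :
    σ.character n (Fin.revPerm * p * Fin.revPerm) = σ.character n p := by
  have rev_mul_rev : (Fin.revPerm * Fin.revPerm : Equiv.Perm (Fin n)) = 1 :=
    Equiv.ext Fin.rev_rev
  rw [character_mul, character_mul, mul_right_comm, ← character_mul, rev_mul_rev,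
    ← character_mul, one_mul]

lemma swapSign_add (i j : ℕ) : σ.swapSign (i + j) = σ.swapSign i * σ.swapSign j := by
  cases σ <;> simp [Statistics.swapSign, pow_add]

lemma swapSign_mul_self (i : ℕ) : σ.swapSign i * σ.swapSign i = 1 := by
  cases σ <;> simp [Statistics.swapSign, ← mul_pow]

lemma conj_swapSign (i : ℕ) : conj (σ.swapSign i) = σ.swapSign i := by
  cases σ <;> simp [Statistics.swapSign]

lemma insertNth_eq_cons_cycleRange (k : Fin (n + 1)) (ξ : X) (η : Fin n → X) :
    (k.insertNth ξ η : Fin (n + 1) → X) =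
      fun i => (Fin.cons ξ η : Fin (n + 1) → X) (k.cycleRange i) := by
  funext i
  cases i using k.succAboveCases with
  | x => simp
  | p j => simp [Fin.cycleRange_succAbove]

lemma cons_comp_decomposeFin (ξ : X) (η : Fin n → X) (p : Equiv.Perm (Fin n)) :
    (fun i => (Fin.cons ξ η : Fin (n + 1) → X) (Equiv.Perm.decomposeFin.symm (0, p) i)) =
      Fin.cons ξ fun i => η (p i) := by
  funext i
  cases i using Fin.cases <;> simp

/-- Conjugating `p` with the cycles that bring `k` and `p k` to the front yields a permutation
fixing `0`. -/
lemma exists_perm_decomposeFin (p : Equiv.Perm (Fin (n + 1))) (k : Fin (n + 1)) :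
    ∃ e : Equiv.Perm (Fin n),
      Equiv.Perm.decomposeFin.symm (0, e) * k.cycleRange = (p k).cycleRange * p := by
  obtain ⟨⟨a, e⟩, he⟩ :=
    Equiv.Perm.decomposeFin.symm.surjective ((p k).cycleRange * p * k.cycleRange⁻¹)
  have ha : a = 0 := by
    rw [← Equiv.Perm.decomposeFin_symm_apply_zero a e, he]
    simp
  exact ⟨e, by rw [← ha, he, inv_mul_cancel_right]⟩

lemma exists_perm_succAbove (p : Equiv.Perm (Fin (n + 1))) (k : Fin (n + 1)) :
    ∃ e : Equiv.Perm (Fin n), (∀ j, p (k.succAbove j) = (p k).succAbove (e j)) ∧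
      ∀ σ : Statistics, σ.swapSign k * σ.character n e =
        σ.character (n + 1) p * σ.swapSign (p k) := by
  obtain ⟨e, he⟩ := exists_perm_decomposeFin p k
  refine ⟨e, fun j => (p k).cycleRange.injective ?_, fun σ => ?_⟩
  · have h := congrArg (fun q : Equiv.Perm (Fin (n + 1)) => q (k.succAbove j)) he
    simp only [Equiv.Perm.mul_apply, Fin.cycleRange_succAbove,
      Equiv.Perm.decomposeFin_symm_apply_succ, Equiv.swap_self, Equiv.refl_apply] at h
    rw [← h, Fin.cycleRange_succAbove]
  · have h := congrArg (σ.character (n + 1)) he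
    rw [character_mul, character_mul, character_decomposeFin, character_cycleRange,
      character_cycleRange] at h
    rw [mul_comm, h, mul_comm]

end ExchangeSymmetry

section Domain

variable {X : Type} [MeasurableSpace X] {μ : Measure X} {u w : X → X → ℝ} {φ φ' : X → ℂ}
  {ψ χ : Wave X} {σ : Statistics} {c : X → X}

lemma FiniteParticle.add (hψ : FiniteParticle σ μ ψ) (hχ : FiniteParticle σ μ χ) :
    FiniteParticle σ μ (ψ + χ) where
  memLp n := (hψ.memLp n).add (hχ.memLp n)
  symm n p := by
    filter_upwards [hψ.symm n p, hχ.symm n p] with η hψη hχη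
    simp only [Pi.add_apply, hψη, hχη, mul_add]
  finite := by
    obtain ⟨N, hN⟩ := hψ.finite
    obtain ⟨M, hM⟩ := hχ.finite
    refine ⟨max N M, fun n hn => ?_⟩
    simpa using (hN n (by omega)).add (hM n (by omega))

variable [SigmaFinite μ]

lemma FiniteParticle.ae_zPoint_symm (hψ : FiniteParticle σ μ ψ) (u : X → X → ℝ) (n : ℕ)
    (p : Equiv.Perm (Fin n)) : ∀ᵐ η ∂(nMeasure μ n), ∀ᵐ ξ ∂μ,
      zPoint u ξ ψ n (fun i => η (p i)) = σ.character n p * zPoint u ξ ψ n η := by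
  filter_upwards [ae_ae_cons (hψ.symm (n + 1) (Equiv.Perm.decomposeFin.symm (0, p)))] with η hη
  filter_upwards [hη] with ξ hξ
  rw [character_decomposeFin, cons_comp_decomposeFin] at hξ
  rw [zPoint_apply, zPoint_apply, hξ, ← cons_comp_decomposeFin, phaseSum_comp_perm]
  ring

lemma FiniteParticle.zAnn (hu : MeasurablePhase u) (hφ : MemLp φ 2 μ)
    (hψ : FiniteParticle σ μ ψ) : FiniteParticle σ μ (zAnn μ u φ ψ) where
  memLp := SquareIntegrable.zAnn hu hφ hψ.memLp
  symm n p := by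
    filter_upwards [hψ.ae_zPoint_symm u n p] with η hη
    rw [FWG.zAnn, FWG.zAnn, ← integral_const_mul]
    refine integral_congr_ae ?_
    filter_upwards [hη] with ξ hξ
    rw [hξ, mul_left_comm]
  finite := by
    obtain ⟨N, hN⟩ := hψ.finite
    refine ⟨N, fun n hn => ?_⟩
    filter_upwards [ae_ae_cons (hN (n + 1) (by omega))] with η hη
    refine integral_eq_zero_of_ae ?_
    filter_upwards [hη] with ξ hξ
    simp [zPoint_apply, hξ]

lemma FiniteParticle.zCre (hu : MeasurablePhase u) (hφ : MemLp φ 2 μ)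
    (hψ : FiniteParticle σ μ ψ) : FiniteParticle σ μ (zCre σ u φ ψ) where
  memLp := SquareIntegrable.zCre hu hφ hψ.memLp
  symm
  | 0, p => by simp [FWG.zCre]
  | n + 1, p => by
    choose e he hsign using fun k => exists_perm_succAbove p k
    filter_upwards [ae_all_iff.2 fun k => ae_removeNth (p k) (hψ.symm n (e k))] with η hη
    have hrem : ∀ k : Fin (n + 1), ψ n (k.removeNth fun i => η (p i)) =
        σ.character n (e k) * ψ n ((p k).removeNth η) := fun k => by
      rw [← hη]
      exact congrArg (ψ n) (funext fun j => congrArg η (he k j))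
    rw [zCre_succ, zCre_succ, mul_left_comm]
    congr 1
    conv_rhs => rw [← Equiv.sum_comp p, Finset.mul_sum]
    refine Finset.sum_congr rfl fun k _ => ?_
    rw [hrem, phaseSum_comp_perm]
    linear_combination (φ (η (p k)) * Circle.exp (phaseSum u (η (p k)) η) *
      ψ n ((p k).removeNth η)) * hsign k σ
  finite := by
    obtain ⟨N, hN⟩ := hψ.finite
    refine ⟨N + 1, fun n hn => ?_⟩
    obtain ⟨n, rfl⟩ := Nat.exists_eq_succ_of_ne_zero (Nat.ne_zero_of_lt hn)
    refine (zCre_succ_congr_ae (χ := 0) (hN n (by omega))).trans (.of_forall fun η => ?_)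
    simp [zCre_succ]

lemma FiniteParticle.modularJ (hc : MeasurePreserving c μ μ) (hw : MeasurablePhase w)
    (hψ : FiniteParticle σ μ ψ) : FiniteParticle σ μ (modularJ c w ψ) where
  memLp := SquareIntegrable.modularJ hc hw hψ.memLp
  symm n p := by
    filter_upwards [(measurePreserving_comp_rev hc).quasiMeasurePreserving.ae
      (hψ.symm n (Fin.revPerm * p * Fin.revPerm))] with η hη
    simp only [Equiv.Perm.mul_apply, Fin.revPerm_apply, Fin.rev_rev, character_rev_conj] at hη
    rw [modularJ_apply, modularJ_apply, totalPhase_comp_perm, hη, map_mul, conj_character,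
      mul_left_comm]
  finite := by
    obtain ⟨N, hN⟩ := hψ.finite
    refine ⟨N, fun n hn => ?_⟩
    filter_upwards [(measurePreserving_comp_rev hc).quasiMeasurePreserving.ae (hN n hn)] with η hη
    simp [modularJ_apply, hη]

lemma preservesDomain_modularJ (hc : MeasurePreserving c μ μ) (hw : MeasurablePhase w) :
    PreservesDomain σ μ (modularJ c w) :=
  ⟨fun _ => FiniteParticle.modularJ hc hw, fun _ _ _ _ => VecEq.modularJ hc⟩

lemma preservesDomain_zField (hu : MeasurablePhase u) (hφ : MemLp φ 2 μ) (hφ' : MemLp φ' 2 μ) :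
    PreservesDomain σ μ (zField σ μ u φ φ') :=
  ⟨fun _ h => (h.zAnn hu hφ).add (h.zCre hu hφ'), fun _ _ _ _ h => h.zAnn.add h.zCre⟩

end Domain

section HermitianConjugation

variable {X : Type} [MeasurableSpace X] {μ : Measure X} {u : X → X → ℝ} {φ φ' : X → ℂ}
  {ψ ψ' χ : Wave X} {σ : Statistics} {n : ℕ}

lemma integrable_conj_mul (hχ : SquareIntegrable μ χ) (hψ : SquareIntegrable μ ψ) (n : ℕ) :
    Integrable (fun η => conj (χ n η) * ψ n η) (nMeasure μ n) :=
  (hχ n).star.integrable_mul (hψ n)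

lemma summable_integral_conj_mul (hψ : FiniteParticle σ μ ψ) (χ : Wave X) :
    Summable fun n => ∫ η, conj (χ n η) * ψ n η ∂(nMeasure μ n) := by
  obtain ⟨N, hN⟩ := hψ.finite
  refine summable_of_ne_finset_zero (s := Finset.range (N + 1)) fun n hn => ?_
  refine integral_eq_zero_of_ae ?_
  filter_upwards [hN n (by simpa using hn)] with η hη
  simp [hη]

lemma conj_fockInner (χ ψ : Wave X) : conj (fockInner μ χ ψ) = fockInner μ ψ χ := by
  simp only [fockInner, Complex.conj_tsum, ← integral_conj, map_mul, Complex.conj_conj, mul_comm]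

lemma fockInner_add_right (hχ : SquareIntegrable μ χ) (hψ : FiniteParticle σ μ ψ)
    (hψ' : FiniteParticle σ μ ψ') :
    fockInner μ χ (ψ + ψ') = fockInner μ χ ψ + fockInner μ χ ψ' := by
  rw [fockInner, fockInner, fockInner, ← (summable_integral_conj_mul hψ χ).tsum_add
    (summable_integral_conj_mul hψ' χ)]
  refine tsum_congr fun n => ?_
  rw [← integral_add (integrable_conj_mul hχ hψ.memLp n) (integrable_conj_mul hχ hψ'.memLp n)]
  simp only [Pi.add_apply, mul_add]

variable [SigmaFinite μ]

lemma integral_conj_mul_zAnn (hu : MeasurablePhase u) (hφ : MemLp φ 2 μ)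
    (hχ : SquareIntegrable μ χ) (hψ : SquareIntegrable μ ψ) (n : ℕ) :
    ∫ η, conj (χ n η) * zAnn μ u φ ψ n η ∂(nMeasure μ n) =
      ∫ z : X × (Fin n → X), φ z.1 * conj (χ n z.2) * zPoint u z.1 ψ n z.2
        ∂(μ.prod (nMeasure μ n)) := by
  have hint : Integrable (fun z : X × (Fin n → X) =>
      φ z.1 * conj (χ n z.2) * zPoint u z.1 ψ n z.2) (μ.prod (nMeasure μ n)) :=
    (memLp_two_mul_prod hφ (hχ n).star).integrable_mul (hψ.zPoint hu n)
  rw [integral_prod_symm _ hint]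
  refine integral_congr_ae (.of_forall fun η => ?_)
  simp only [zAnn, ← integral_const_mul]
  congr 1 with ξ
  ring

lemma FiniteParticle.ae_insertNth (hψ : FiniteParticle σ μ ψ) (k : Fin (n + 1)) :
    ∀ᵐ z ∂(μ.prod (nMeasure μ n)), ψ (n + 1) (k.insertNth z.1 z.2) =
      σ.swapSign k * ψ (n + 1) (Fin.cons z.1 z.2) := by
  filter_upwards [measurePreserving_cons.quasiMeasurePreserving.ae
    (hψ.symm (n + 1) k.cycleRange)] with z hz
  rw [insertNth_eq_cons_cycleRange, hz, character_cycleRange]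

lemma integral_conj_zCre_term_mul (hψ : FiniteParticle σ μ ψ) (φ : X → ℂ) (χ : Wave X)
    (k : Fin (n + 1)) :
    ∫ η, conj (σ.swapSign k * conj (φ (η k)) * Circle.exp (phaseSum u (η k) η) *
        χ n (k.removeNth η)) * ψ (n + 1) η ∂(nMeasure μ (n + 1)) =
      (Real.sqrt (n + 1) : ℂ)⁻¹ * ∫ z : X × (Fin n → X),
        φ z.1 * conj (χ n z.2) * zPoint u z.1 ψ n z.2 ∂(μ.prod (nMeasure μ n)) := by
  rw [← (measurePreserving_insertNth k).integral_comp
    (MeasurableEquiv.piFinSuccAbove (fun _ => X) k).symm.measurableEmbedding, ← integral_const_mul]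
  refine integral_congr_ae ?_
  filter_upwards [hψ.ae_insertNth k] with z hz
  simp only [hz, Fin.insertNth_apply_same, Fin.removeNth_insertNth, phaseSum_insertNth,
    ← phaseSum_cons, zPoint_apply, map_mul, conj_swapSign, Complex.conj_conj, conj_circleExp]
  rw [mul_left_comm _ (Real.sqrt (n + 1) : ℂ), inv_mul_cancel_left₀ (sqrt_succ_ne_zero n)]
  linear_combination (φ z.1 * conj (χ n z.2) * Circle.exp (-phaseSum u z.1
    (Fin.cons z.1 z.2 : Fin (n + 1) → X)) * ψ (n + 1) (Fin.cons z.1 z.2)) *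
    swapSign_mul_self (σ := σ) k

lemma integral_conj_zCre_mul (hu : MeasurablePhase u) (hφ : MemLp φ 2 μ)
    (hχ : SquareIntegrable μ χ) (hψ : FiniteParticle σ μ ψ) (n : ℕ) :
    ∫ η, conj (zCre σ u (fun ξ => conj (φ ξ)) χ (n + 1) η) * ψ (n + 1) η ∂(nMeasure μ (n + 1)) =
      ∫ z : X × (Fin n → X), φ z.1 * conj (χ n z.2) * zPoint u z.1 ψ n z.2
        ∂(μ.prod (nMeasure μ n)) := by
  have hint (k : Fin (n + 1)) : Integrable (fun η => conj (σ.swapSign k * conj (φ (η k)) *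
      Circle.exp (phaseSum u (η k) η) * χ n (k.removeNth η)) * ψ (n + 1) η)
      (nMeasure μ (n + 1)) :=
    (hχ.zCre_term hu hφ.star (σ.swapSign k) k).star.integrable_mul (hψ.memLp (n + 1))
  have hsqrt : (n + 1 : ℂ) * ((Real.sqrt (n + 1) : ℂ)⁻¹ * (Real.sqrt (n + 1) : ℂ)⁻¹) = 1 := by
    rw [← mul_inv, ← Complex.ofReal_mul, Real.mul_self_sqrt (by positivity)]
    push_cast
    exact mul_inv_cancel₀ (Nat.cast_add_one_ne_zero n)
  simp only [zCre_succ, map_mul (starRingEnd ℂ) (Real.sqrt (n + 1) : ℂ)⁻¹, map_inv₀, map_sum,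
    Complex.conj_ofReal, mul_assoc (Real.sqrt (n + 1) : ℂ)⁻¹, Finset.sum_mul]
  rw [integral_const_mul, integral_finsetSum _ fun k _ => hint k]
  simp only [integral_conj_zCre_term_mul hψ]
  rw [Finset.sum_const, Finset.card_univ, Fintype.card_fin, nsmul_eq_mul]
  push_cast
  linear_combination (∫ z : X × (Fin n → X), φ z.1 * conj (χ n z.2) * zPoint u z.1 ψ n z.2
    ∂(μ.prod (nMeasure μ n))) * hsqrt

lemma fockInner_zAnn_right (hu : MeasurablePhase u) (hφ : MemLp φ 2 μ)
    (hχ : SquareIntegrable μ χ) (hψ : FiniteParticle σ μ ψ) :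
    fockInner μ χ (zAnn μ u φ ψ) = fockInner μ (zCre σ u (fun ξ => conj (φ ξ)) χ) ψ := by
  have hvac : ∫ η, conj (zCre σ u (fun ξ => conj (φ ξ)) χ 0 η) * ψ 0 η ∂(nMeasure μ 0) = 0 := by
    simp [zCre]
  rw [fockInner, fockInner, (summable_integral_conj_mul hψ _).tsum_eq_zero_add, hvac, zero_add]
  refine tsum_congr fun n => ?_
  rw [integral_conj_mul_zAnn hu hφ hχ hψ.memLp, integral_conj_zCre_mul hu hφ hχ hψ]

lemma fockInner_zCre_right (hu : MeasurablePhase u) (hφ : MemLp φ 2 μ)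
    (hχ : FiniteParticle σ μ χ) (hψ : SquareIntegrable μ ψ) :
    fockInner μ χ (zCre σ u φ ψ) = fockInner μ (zAnn μ u (fun ξ => conj (φ ξ)) χ) ψ := by
  have h := fockInner_zAnn_right hu hφ.star hψ hχ
  simp only [Pi.star_apply, RCLike.star_def, Complex.conj_conj] at h
  rw [← conj_fockInner, ← h, conj_fockInner]
  rfl

theorem isHermitianConj_zField (hu : MeasurablePhase u) (hφ : MemLp φ 2 μ) (hφ' : MemLp φ' 2 μ) :
    IsHermitianConj σ μ (zField σ μ u φ φ')
      (zField σ μ u (fun ξ => conj (φ' ξ)) fun ξ => conj (φ ξ)) := by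
  intro χ ψ hχ hψ
  have hann : FiniteParticle σ μ (zAnn μ u (fun ξ => conj (φ' ξ)) χ) := hχ.zAnn hu hφ'.star
  have hcre : FiniteParticle σ μ (zCre σ u (fun ξ => conj (φ ξ)) χ) := hχ.zCre hu hφ.star
  calc fockInner μ χ (zField σ μ u φ φ' ψ)
      = fockInner μ χ (zAnn μ u φ ψ) + fockInner μ χ (zCre σ u φ' ψ) :=
        fockInner_add_right hχ.memLp (hψ.zAnn hu hφ) (hψ.zCre hu hφ')
    _ = fockInner μ (zCre σ u (fun ξ => conj (φ ξ)) χ) ψ +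
          fockInner μ (zAnn μ u (fun ξ => conj (φ' ξ)) χ) ψ := by
        rw [fockInner_zAnn_right hu hφ hχ.memLp hψ, fockInner_zCre_right hu hφ' hχ hψ.memLp]
    _ = _ := by
        rw [zField, ← conj_fockInner ψ (_ + _), fockInner_add_right hψ.memLp hann hcre, map_add,
          conj_fockInner, conj_fockInner, add_comm]

end HermitianConjugation

section RightOperators

variable {X : Type} {u v w : X → X → ℝ} {φ : X → ℂ} {ψ χ : Wave X} {σ : Statistics} {c : X → X}
  {n : ℕ}

/-- Reversal of the order of the particles. -/
def reverse (ψ : Wave X) : Wave X := fun n η => ψ n fun i => η i.rev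

/-- The operator `Z(ξ)` with phases `v`, removing the last particle instead of the first. -/
def zPointRight (v : X → X → ℝ) (ξ : X) : Wave X → Wave X := conjByJ reverse (zPoint v ξ)

/-- `∫ φ Z` with phases `v`, acting from the right end of the sequence of particles. -/
def zAnnRight [MeasurableSpace X] (μ : Measure X) (v : X → X → ℝ) (φ : X → ℂ) :
    Wave X → Wave X := conjByJ reverse (zAnn μ v φ)

/-- `∫ φ Z*` with phases `v`, acting from the right end of the sequence of particles. -/
def zCreRight (σ : Statistics) (v : X → X → ℝ) (φ : X → ℂ) : Wave X → Wave X :=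
  conjByJ reverse (zCre σ v φ)

lemma reverse_reverse (ψ : Wave X) : reverse (reverse ψ) = ψ := by
  funext n η
  simp only [reverse, Fin.rev_rev]

lemma reverse_add (ψ χ : Wave X) : reverse (ψ + χ) = reverse ψ + reverse χ := rfl

lemma snoc_comp_rev (ξ : X) (η : Fin n → X) :
    (fun i => (Fin.snoc η ξ : Fin (n + 1) → X) i.rev) = Fin.cons ξ fun i => η i.rev :=
  funext fun i => Fin.snoc_rev ξ η i

lemma cons_comp_rev (ξ : X) (η : Fin n → X) :
    (fun i => (Fin.cons ξ (fun j => η j.rev) : Fin (n + 1) → X) i.rev) = Fin.snoc η ξ := by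
  simp only [← snoc_comp_rev, Fin.rev_rev]

lemma removeNth_comp_rev (η : Fin (n + 1) → X) (k : Fin (n + 1)) :
    (k.rev.removeNth fun i => η i.rev) = fun i => k.removeNth η i.rev := by
  funext i
  simp [Fin.removeNth, Fin.rev_succAbove]

lemma zPointRight_apply (v : X → X → ℝ) (ξ : X) (ψ : Wave X) (η : Fin n → X) :
    zPointRight v ξ ψ n η = (Real.sqrt (n + 1) : ℂ) *
      (Circle.exp (-phaseSum v ξ (Fin.snoc η ξ : Fin (n + 1) → X)) *
        ψ (n + 1) (Fin.snoc η ξ)) := by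
  simp only [zPointRight, conjByJ, reverse, zPoint_apply, cons_comp_rev]
  rw [← snoc_comp_rev, phaseSum_comp_rev]

lemma zCreRight_zero (η : Fin 0 → X) : zCreRight σ v φ ψ 0 η = 0 := rfl

lemma zCreRight_succ (σ : Statistics) (v : X → X → ℝ) (φ : X → ℂ) (ψ : Wave X)
    (η : Fin (n + 1) → X) :
    zCreRight σ v φ ψ (n + 1) η = (Real.sqrt (n + 1) : ℂ)⁻¹ * ∑ k : Fin (n + 1),
      σ.swapSign k.rev * φ (η k) * Circle.exp (phaseSum v (η k) η) * ψ n (k.removeNth η) := by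
  rw [zCreRight, conjByJ, reverse, zCre_succ, ← Equiv.sum_comp Fin.revPerm]
  simp only [Fin.revPerm_apply, Fin.rev_rev, reverse, removeNth_comp_rev, phaseSum_comp_rev]

lemma zCreRight_add : zCreRight σ v φ (ψ + χ) = zCreRight σ v φ ψ + zCreRight σ v φ χ := by
  simp only [zCreRight, conjByJ, reverse_add, zCre_add]

variable [MeasurableSpace X] {μ : Measure X}

/-- Phases `u` of the `Z`-operators and `w` of the scattering operator that fit together, and are
invariant under the charge conjugation `c`. -/
structure CompatiblePhases (μ : Measure X) (c : X → X) (u w : X → X → ℝ) : Prop where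
  involutive : Function.Involutive c
  measurePreserving : MeasurePreserving c μ μ
  diag : ∀ ξ, u ξ ξ = 0
  pair : ∀ ξ η, w ξ η + w η ξ = u ξ η + u η ξ
  conj_phase : ∀ ξ η, u (c ξ) (c η) = u ξ η
  conj_scattering : ∀ ξ η, w (c ξ) (c η) = w ξ η
  measurable_phase : MeasurablePhase u
  measurable_scattering : MeasurablePhase w

namespace CompatiblePhases

lemma phaseSum_conj_rev (h : CompatiblePhases μ c u w) (ξ : X) (η : Fin n → X) :
    phaseSum u (c ξ) (fun i => c (η i.rev)) = phaseSum u ξ η := by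
  rw [← phaseSum_comp_rev ξ η]
  simp only [phaseSum, h.conj_phase]

lemma totalPhase_conj_rev (h : CompatiblePhases μ c u w) (η : Fin n → X) :
    totalPhase w (fun i => c (η i.rev)) = totalPhase w η := by
  rw [← totalPhase_comp_perm η Fin.revPerm]
  simp only [totalPhase, phaseSum, h.conj_scattering, Fin.revPerm_apply]

lemma totalPhase_eq (h : CompatiblePhases μ c u w) (η : Fin (n + 1) → X) (k : Fin (n + 1)) :
    totalPhase w η = phaseSum u (η k) η + phaseSum (Function.swap u) (η k) η +
      totalPhase w (k.removeNth η) := by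
  have diag_scattering : w (η k) (η k) = 0 := by
    linarith [h.pair (η k) (η k), h.diag (η k)]
  rw [totalPhase_removeNth η k, diag_scattering, phaseSum_removeNth _ η k,
    phaseSum_removeNth _ η k, Function.swap, h.diag]
  simp only [h.pair, Finset.sum_add_distrib, phaseSum]
  ring

/-- The scattering phases of `ξ` with all other particles are the sum of its phases from the left
and from the right, so that conjugation by `J` leaves only the latter. -/
lemma conjByJ_zPoint (h : CompatiblePhases μ c u w) (ξ : X) (ψ : Wave X) :
    conjByJ (modularJ c w) (zPoint u (c ξ)) ψ = zPointRight (Function.swap u) ξ ψ := by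
  funext n η
  have hcons : (Fin.cons (c ξ) fun i => c (η i.rev) : Fin (n + 1) → X) =
      fun i => c ((Fin.snoc η ξ : Fin (n + 1) → X) i.rev) := by
    funext i
    rw [Fin.snoc_rev]
    cases i using Fin.cases <;> simp
  have hphase := h.totalPhase_eq (Fin.snoc η ξ : Fin (n + 1) → X) (Fin.last n)
  rw [Fin.snoc_last, Fin.removeNth_last, Fin.init_snoc] at hphase
  simp only [conjByJ, modularJ_apply, zPoint_apply, zPointRight_apply, hcons, map_mul,
    Complex.conj_ofReal, Complex.conj_conj, conj_circleExp, neg_neg, h.phaseSum_conj_rev,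
    h.totalPhase_conj_rev, Fin.rev_rev, h.involutive _, hphase, Circle.exp_add,
    Circle.coe_mul]
  rw [Circle.exp_neg, Circle.exp_neg (totalPhase w η), Circle.coe_inv, Circle.coe_inv]
  field_simp [Circle.coe_ne_zero]

lemma conjByJ_zAnn (h : CompatiblePhases μ c u w) (φ : X → ℂ) (ψ : Wave X) :
    conjByJ (modularJ c w) (zAnn μ u φ) ψ =
      zAnnRight μ (Function.swap u) (fun ξ => conj (φ (c ξ))) ψ := by
  have hc : MeasurableEmbedding c :=
    (MeasurableEquiv.ofInvolutive c h.involutive h.measurePreserving.measurable).measurableEmbedding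
  funext n η
  have hpoint (ξ : X) := congrFun₂ (h.conjByJ_zPoint ξ ψ) n η
  calc conjByJ (modularJ c w) (zAnn μ u φ) ψ n η
      = Circle.exp (totalPhase w η) * ∫ ξ, conj (φ ξ *
          zPoint u ξ (modularJ c w ψ) n fun i => c (η i.rev)) ∂μ := by
        rw [conjByJ, modularJ_apply, zAnn, integral_conj]
    _ = ∫ ξ, conj (φ (c ξ)) * conjByJ (modularJ c w) (zPoint u (c ξ)) ψ n η ∂μ := by
        rw [← h.measurePreserving.integral_comp hc, ← integral_const_mul]
        simp only [conjByJ, modularJ_apply (n := n), map_mul, mul_left_comm]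
    _ = ∫ ξ, conj (φ (c ξ)) * zPointRight (Function.swap u) ξ ψ n η ∂μ := by
        simp only [hpoint]

lemma conjByJ_zCre (h : CompatiblePhases μ c u w) (φ : X → ℂ) (ψ : Wave X) :
    conjByJ (modularJ c w) (zCre σ u φ) ψ =
      zCreRight σ (Function.swap u) (fun ξ => conj (φ (c ξ))) ψ := by
  funext n η
  cases n with
  | zero => simp [conjByJ, modularJ_apply, zCreRight_zero, zCre]
  | succ n =>
    rw [zCreRight_succ, conjByJ, modularJ_apply, zCre_succ, ← Equiv.sum_comp Fin.revPerm, map_mul,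
      map_inv₀, Complex.conj_ofReal, map_sum, mul_left_comm, Finset.mul_sum]
    congr 1
    refine Finset.sum_congr rfl fun k _ => ?_
    have hrem : (k.rev.removeNth fun i => c (η i.rev)) = fun i => c (k.removeNth η i.rev) :=
      removeNth_comp_rev (fun i => c (η i)) k
    simp only [Fin.revPerm_apply, Fin.rev_rev, hrem, h.phaseSum_conj_rev, h.totalPhase_conj_rev,
      modularJ_apply, map_mul, conj_swapSign, conj_circleExp, Complex.conj_conj, h.involutive _,
      h.totalPhase_eq η k, Circle.exp_add, Circle.coe_mul]
    rw [Circle.exp_neg, Circle.exp_neg, Circle.coe_inv, Circle.coe_inv]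
    field_simp [Circle.coe_ne_zero]

end CompatiblePhases

end RightOperators

/-! ### Commutators and contractions -/

section PointwiseCommutators

variable {X Y : Type} [MeasurableSpace Y] {ν : Measure Y} {u v : X → X → ℝ} {φ χ : X → ℂ}
  {ψ : Wave X} {σ : Statistics} {n : ℕ}

lemma zPoint_const_mul (a : ℂ) (ξ : X) (η : Fin n → X) :
    zPoint u ξ (fun m ζ => a * ψ m ζ) n η = a * zPoint u ξ ψ n η := by
  rw [zPoint_apply, zPoint_apply]
  ring

lemma zPoint_integral (ξ : X) (F : Y → Wave X) (η : Fin n → X) :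
    zPoint u ξ (fun m ζ => ∫ y, F y m ζ ∂ν) n η = ∫ y, zPoint u ξ (F y) n η ∂ν := by
  simp only [zPoint_apply, integral_const_mul]

lemma zPointRight_zPoint (ξ ξ' : X) (ψ : Wave X) :
    zPointRight (Function.swap u) ξ' (zPoint u ξ ψ) =
      zPoint u ξ (zPointRight (Function.swap u) ξ' ψ) := by
  funext n η
  simp only [zPointRight_apply, zPoint_apply, Fin.cons_snoc_eq_snoc_cons, phaseSum_cons,
    phaseSum_snoc, neg_add, coe_circleExp_add, Function.swap]
  ring

/-- The extra term is the summand `k = 0` of `zCreRight_succ`, which removes `ξ` itself. -/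
lemma zPoint_zCreRight (ξ : X) (η : Fin n → X) :
    zPoint u ξ (zCreRight σ (Function.swap u) φ ψ) n η =
      zCreRight σ (Function.swap u) φ (zPoint u ξ ψ) n η + σ.swapSign n * φ ξ *
        Circle.exp (phaseSum (Function.swap u) ξ η - phaseSum u ξ η) * ψ n η := by
  have hpos : -phaseSum u ξ (Fin.cons ξ η : Fin (n + 1) → X) +
      phaseSum (Function.swap u) ξ (Fin.cons ξ η : Fin (n + 1) → X) =
        phaseSum (Function.swap u) ξ η - phaseSum u ξ η := by
    rw [phaseSum_cons, phaseSum_cons, Function.swap]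
    ring
  rw [zPoint_apply, zCreRight_succ, mul_left_comm, mul_inv_cancel_left₀ (sqrt_succ_ne_zero n),
    Fin.sum_univ_succ, mul_add, add_comm, ← hpos, coe_circleExp_add]
  simp only [Fin.cons_zero, Fin.cons_succ, Fin.removeNth_zero, Fin.tail_cons, Fin.rev_zero,
    Fin.val_last, Fin.rev_succ, Fin.val_castSucc]
  congr 1
  · cases n with
    | zero => simp [zCreRight_zero]
    | succ n =>
      rw [zCreRight_succ, Finset.mul_sum, Finset.mul_sum]
      refine Finset.sum_congr rfl fun k _ => ?_
      have hphase : -phaseSum u ξ (Fin.cons ξ η : Fin (n + 2) → X) +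
          phaseSum (Function.swap u) (η k) (Fin.cons ξ η : Fin (n + 2) → X) =
            phaseSum (Function.swap u) (η k) η +
              -phaseSum u ξ (Fin.cons ξ (k.removeNth η) : Fin (n + 1) → X) := by
        simp only [phaseSum_cons, phaseSum_removeNth ξ η k, Function.swap]
        ring
      have hexp := congrArg (fun t : ℝ => (Circle.exp t : ℂ)) hphase
      simp only [coe_circleExp_add] at hexp
      have hcons : k.succ.removeNth (Fin.cons ξ η : Fin (n + 2) → X) =
          Fin.cons ξ (k.removeNth η) := by
        funext i
        cases i using Fin.cases <;> simp [Fin.removeNth]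
      rw [zPoint_apply, hcons]
      field_simp [sqrt_succ_ne_zero n]
      linear_combination σ.swapSign k.rev * φ (η k) * ψ (n + 1) (Fin.cons ξ (k.removeNth η)) * hexp
  · ring

/-- Creating a particle at `k` from the right and then one at `l` from the left passes as many
other particles as performing these steps in the opposite order. -/
lemma swapSign_rev_mul_swapSign (k : Fin (n + 2)) (l : Fin (n + 1)) :
    σ.swapSign k.rev * σ.swapSign l =
      σ.swapSign (k.succAbove l) * σ.swapSign (l.predAbove k).rev := by
  rw [← swapSign_add, ← swapSign_add]
  congr 1
  rw [Fin.val_rev, Fin.val_rev]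
  rcases lt_or_ge l.castSucc k with h | h
  · rw [Fin.succAbove_of_castSucc_lt _ _ h, Fin.predAbove_of_castSucc_lt _ _ h, Fin.val_castSucc,
      Fin.val_pred]
    rw [Fin.lt_def, Fin.val_castSucc] at h
    omega
  · rw [Fin.succAbove_of_le_castSucc _ _ h, Fin.predAbove_of_le_castSucc _ _ h, Fin.val_succ,
      Fin.coe_castPred]
    rw [Fin.le_def, Fin.val_castSucc] at h
    omega

lemma phaseSum_add_phaseSum_removeNth (η : Fin (n + 2) → X) (k : Fin (n + 2)) (l : Fin (n + 1)) :
    phaseSum (Function.swap u) (η k) η + phaseSum u (η (k.succAbove l)) (k.removeNth η) =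
      phaseSum u (η (k.succAbove l)) η +
        phaseSum (Function.swap u) (η k) ((k.succAbove l).removeNth η) := by
  rw [phaseSum_removeNth _ η (k.succAbove l), phaseSum_removeNth _ η k, Function.swap]
  ring

lemma zCreRight_zCre :
    zCreRight σ (Function.swap u) φ (zCre σ u χ ψ) =
      zCre σ u χ (zCreRight σ (Function.swap u) φ ψ) := by
  funext n η
  match n with
  | 0 => rfl
  | 1 => simp [zCreRight_succ, zCreRight_zero, zCre]
  | n + 2 =>
    have involutive : Function.Involutive fun z : Fin (n + 2) × Fin (n + 1) =>
        (z.1.succAbove z.2, z.2.predAbove z.1) := fun z => by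
      simp [Fin.succAbove_succAbove_predAbove, Fin.predAbove_predAbove_succAbove]
    simp only [zCreRight_succ, zCre_succ, Finset.mul_sum]
    rw [← Fintype.sum_prod_type', ← Fintype.sum_prod_type']
    refine Fintype.sum_equiv involutive.toPerm _ _ fun ⟨k, l⟩ => ?_
    have hphase := phaseSum_add_phaseSum_removeNth (u := u) η k l
    have hk : (k.succAbove l).removeNth η (l.predAbove k) = η k :=
      congrArg η (Fin.succAbove_succAbove_predAbove k l)
    have hl : k.removeNth η l = η (k.succAbove l) := rfl
    simp only [Function.Involutive.coe_toPerm, hk, hl, ← Fin.removeNth_removeNth_eq_swap]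
    have hexp := congrArg (fun t : ℝ => (Circle.exp t : ℂ)) hphase
    simp only [coe_circleExp_add] at hexp
    linear_combination ((Real.sqrt ((n + 1 : ℕ) + 1) : ℂ)⁻¹ * (Real.sqrt (n + 1) : ℂ)⁻¹ * φ (η k) *
      χ (η (k.succAbove l)) * ψ n (l.removeNth (k.removeNth η))) *
      (Circle.exp (phaseSum (Function.swap u) (η k) η) *
        Circle.exp (phaseSum u (η (k.succAbove l)) (k.removeNth η)) *
          swapSign_rev_mul_swapSign (σ := σ) k l +
        σ.swapSign (k.succAbove l) * σ.swapSign (l.predAbove k).rev * hexp)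

end PointwiseCommutators

section SmearedCommutators

variable {X : Type} [MeasurableSpace X] {μ : Measure X} {u v w : X → X → ℝ}
  {φ φ' χ χ' ρ : X → ℂ} {ψ ψ' : Wave X} {σ : Statistics} {c : X → X} {n : ℕ}

/-- The commutator of a left and a right operator on the `n`-particle configuration `η`, up to
sign: the one-particle pairing with density `ρ`, dressed with the phases between `ξ` and `η`. -/
def contraction (μ : Measure X) (u : X → X → ℝ) (ρ : X → ℂ) (η : Fin n → X) : ℂ :=
  ∫ ξ, ρ ξ * Circle.exp (phaseSum (Function.swap u) ξ η - phaseSum u ξ η) ∂μ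

/-- Multiplication by the contraction with density `ρ`; the sign comes from moving one particle
past all others. -/
def contractionOp (σ : Statistics) (μ : Measure X) (u : X → X → ℝ) (ρ : X → ℂ) (ψ : Wave X) :
    Wave X := fun n η => σ.swapSign n * contraction μ u ρ η * ψ n η

lemma integrable_contraction (hu : MeasurablePhase u) (hρ : Integrable ρ μ) (η : Fin n → X) :
    Integrable (fun ξ => ρ ξ *
      Circle.exp (phaseSum (Function.swap u) ξ η - phaseSum u ξ η)) μ := by
  have hmeas : Measurable fun ξ =>
      (Circle.exp (phaseSum (Function.swap u) ξ η - phaseSum u ξ η) : ℂ) := by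
    simp only [sub_eq_add_neg]
    exact measurable_circleExp_add (hu.swap.phaseSum measurable_id measurable_const)
      (measurable_circleExp_neg (hu.phaseSum measurable_id measurable_const))
  have hmem := memLp_circleExp_mul (memLp_one_iff_integrable.2 hρ) hmeas
  simpa only [mul_comm] using memLp_one_iff_integrable.1 hmem

variable [SigmaFinite μ]

lemma VecEq.reverse (h : VecEq μ ψ ψ') : VecEq μ (reverse ψ) (reverse ψ') :=
  fun n => (measurePreserving_comp_perm Fin.revPerm).quasiMeasurePreserving.ae (h n)

lemma SquareIntegrable.reverse (hψ : SquareIntegrable μ ψ) : SquareIntegrable μ (reverse ψ) :=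
  fun n => (hψ n).comp_measurePreserving (measurePreserving_comp_perm Fin.revPerm)

lemma SquareIntegrable.zAnnRight (hv : MeasurablePhase v) (hφ : MemLp φ 2 μ)
    (hψ : SquareIntegrable μ ψ) : SquareIntegrable μ (zAnnRight μ v φ ψ) :=
  (hψ.reverse.zAnn hv hφ).reverse

lemma SquareIntegrable.zCreRight (hv : MeasurablePhase v) (hφ : MemLp φ 2 μ)
    (hψ : SquareIntegrable μ ψ) : SquareIntegrable μ (zCreRight σ v φ ψ) :=
  (SquareIntegrable.zCre hv hφ hψ.reverse).reverse

lemma zAnnRight_add (hv : MeasurablePhase v) (hφ : MemLp φ 2 μ) (hψ : SquareIntegrable μ ψ)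
    (hψ' : SquareIntegrable μ ψ') :
    VecEq μ (zAnnRight μ v φ (ψ + ψ')) (zAnnRight μ v φ ψ + zAnnRight μ v φ ψ') :=
  (zAnn_add hv hφ hψ.reverse hψ'.reverse).reverse

lemma SquareIntegrable.ae_zPointRight_zPoint (hu : MeasurablePhase u) (hv : MeasurablePhase v)
    (hψ : SquareIntegrable μ ψ) (n : ℕ) :
    ∀ᵐ η ∂(nMeasure μ n), MemLp (fun z : X × X =>
      zPointRight v z.2 (FWG.zPoint u z.1 ψ) n η) 2 (μ.prod μ) := by
  have hsnoc := (MeasurePreserving.id μ).prod (measurePreserving_snoc (μ := μ) (n := n))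
  have hassoc : MeasurePreserving (MeasurableEquiv.prodAssoc : (X × X) × (Fin n → X) ≃ᵐ _)
      ((μ.prod μ).prod (nMeasure μ n)) (μ.prod (μ.prod (nMeasure μ n))) :=
    measurePreserving_prodAssoc _ _ _
  have hmem := (hψ.zPoint hu (n + 1)).comp_measurePreserving (hsnoc.comp hassoc)
  have hphase : Measurable fun z : (X × X) × (Fin n → X) =>
      (Circle.exp (-phaseSum v z.1.2 (Fin.snoc z.2 z.1.2 : Fin (n + 1) → X)) : ℂ) :=
    measurable_circleExp_neg (hv.phaseSum (by fun_prop)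
      ((measurePreserving_snoc (μ := μ)).measurable.comp (by fun_prop : Measurable
        fun z : (X × X) × (Fin n → X) => (z.1.2, z.2))))
  have hpoint : MemLp (fun z : (X × X) × (Fin n → X) =>
      zPointRight v z.1.2 (FWG.zPoint u z.1.1 ψ) n z.2) 2 ((μ.prod μ).prod (nMeasure μ n)) := by
    simp only [zPointRight_apply]
    exact (memLp_circleExp_mul hmem hphase).const_mul _
  exact ae_memLp_two_slice hpoint

lemma zAnnRight_zAnn (hu : MeasurablePhase u) (hφ : MemLp φ 2 μ) (hχ : MemLp χ 2 μ)
    (hψ : SquareIntegrable μ ψ) :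
    VecEq μ (zAnnRight μ (Function.swap u) φ (zAnn μ u χ ψ))
      (zAnn μ u χ (zAnnRight μ (Function.swap u) φ ψ)) := by
  intro n
  filter_upwards [hψ.ae_zPointRight_zPoint hu hu.swap n] with η hη
  have hint : Integrable (fun z : X × X => φ z.2 * (χ z.1 *
      zPointRight (Function.swap u) z.2 (zPoint u z.1 ψ) n η)) (μ.prod μ) :=
    ((memLp_two_mul_prod hχ hφ).integrable_mul hη).congr (.of_forall fun z => by
      simp only [Pi.mul_apply]; ring)
  have hleft (ξ' : X) : zPointRight (Function.swap u) ξ' (zAnn μ u χ ψ) n η =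
      ∫ ξ, χ ξ * zPointRight (Function.swap u) ξ' (zPoint u ξ ψ) n η ∂μ := by
    simp only [zPointRight_apply, zAnn, ← integral_const_mul, mul_left_comm]
  have hright (ξ : X) : zPoint u ξ (zAnnRight μ (Function.swap u) φ ψ) n η =
      ∫ ξ', φ ξ' * zPoint u ξ (zPointRight (Function.swap u) ξ' ψ) n η ∂μ := by
    simp only [← zPoint_const_mul, ← zPoint_integral]
    rfl
  calc zAnnRight μ (Function.swap u) φ (zAnn μ u χ ψ) n η
      = ∫ ξ', φ ξ' * zPointRight (Function.swap u) ξ' (zAnn μ u χ ψ) n η ∂μ := rfl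
    _ = ∫ ξ', ∫ ξ, φ ξ' * (χ ξ * zPointRight (Function.swap u) ξ' (zPoint u ξ ψ) n η) ∂μ ∂μ := by
        simp only [hleft, integral_const_mul]
    _ = ∫ ξ, ∫ ξ', φ ξ' * (χ ξ * zPointRight (Function.swap u) ξ' (zPoint u ξ ψ) n η) ∂μ ∂μ :=
        (integral_integral_swap hint).symm
    _ = ∫ ξ, χ ξ * zPoint u ξ (zAnnRight μ (Function.swap u) φ ψ) n η ∂μ := by
        simp only [hright, ← integral_const_mul, zPointRight_zPoint, mul_left_comm]

lemma ae_hasIntegral_zCreRight_zPoint (hu : MeasurablePhase u) (hχ : MemLp χ 2 μ)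
    (hψ : SquareIntegrable μ ψ) :
    ∀ (n : ℕ), ∀ᵐ η ∂(nMeasure μ n),
      Integrable (fun ξ => χ ξ * zCreRight σ v φ (zPoint u ξ ψ) n η) μ ∧
      ∫ ξ, χ ξ * zCreRight σ v φ (zPoint u ξ ψ) n η ∂μ = zCreRight σ v φ (zAnn μ u χ ψ) n η
  | 0 => .of_forall fun η => by simp [zCreRight_zero]
  | n + 1 => by
    filter_upwards [ae_all_iff.2 fun k => ae_removeNth k (hψ.ae_zPoint hu n)] with η hη
    have hint (k : Fin (n + 1)) : Integrable (fun ξ =>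
        σ.swapSign k.rev * φ (η k) * Circle.exp (phaseSum v (η k) η) *
          (χ ξ * zPoint u ξ ψ n (k.removeNth η))) μ :=
      (hχ.integrable_mul (hη k)).const_mul _
    have hterm (ξ : X) : χ ξ * zCreRight σ v φ (zPoint u ξ ψ) (n + 1) η =
        (Real.sqrt (n + 1) : ℂ)⁻¹ * ∑ k : Fin (n + 1),
          σ.swapSign k.rev * φ (η k) * Circle.exp (phaseSum v (η k) η) *
            (χ ξ * zPoint u ξ ψ n (k.removeNth η)) := by
      rw [zCreRight_succ, mul_left_comm, Finset.mul_sum]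
      simp only [mul_left_comm]
    simp only [hterm]
    refine ⟨(integrable_finsetSum _ fun k _ => hint k).const_mul _, ?_⟩
    rw [integral_const_mul, integral_finsetSum _ fun k _ => hint k, zCreRight_succ]
    simp only [integral_const_mul, zAnn]

lemma zAnn_zCreRight (hu : MeasurablePhase u) (hφ : MemLp φ 2 μ) (hχ : MemLp χ 2 μ)
    (hψ : SquareIntegrable μ ψ) :
    VecEq μ (zAnn μ u χ (zCreRight σ (Function.swap u) φ ψ))
      (zCreRight σ (Function.swap u) φ (zAnn μ u χ ψ) +
        contractionOp σ μ u (fun ξ => χ ξ * φ ξ) ψ) := by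
  intro n
  filter_upwards [ae_hasIntegral_zCreRight_zPoint (σ := σ) (v := Function.swap u) (φ := φ)
    hu hχ hψ n] with η ⟨hint, hintegral⟩
  have hcontr : Integrable (fun ξ => σ.swapSign n * ψ n η *
      (χ ξ * φ ξ * Circle.exp (phaseSum (Function.swap u) ξ η - phaseSum u ξ η))) μ :=
    (integrable_contraction hu (hχ.integrable_mul hφ) η).const_mul _
  calc zAnn μ u χ (zCreRight σ (Function.swap u) φ ψ) n η
      = ∫ ξ, (χ ξ * zCreRight σ (Function.swap u) φ (zPoint u ξ ψ) n η + σ.swapSign n * ψ n η *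
          (χ ξ * φ ξ * Circle.exp (phaseSum (Function.swap u) ξ η - phaseSum u ξ η))) ∂μ := by
        simp only [zAnn, zPoint_zCreRight]
        congr 1 with ξ
        ring
    _ = _ := by
        rw [integral_add hint hcontr, hintegral, integral_const_mul, Pi.add_apply, Pi.add_apply,
          contractionOp, contraction, mul_right_comm]

lemma zAnnRight_zCre (hu : MeasurablePhase u) (hφ : MemLp φ 2 μ) (hχ : MemLp χ 2 μ)
    (hψ : SquareIntegrable μ ψ) :
    VecEq μ (zAnnRight μ (Function.swap u) φ (zCre σ u χ ψ))
      (zCre σ u χ (zAnnRight μ (Function.swap u) φ ψ) +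
        contractionOp σ μ (Function.swap u) (fun ξ => φ ξ * χ ξ) ψ) := by
  have hcontr : reverse (contractionOp σ μ (Function.swap u) (fun ξ => φ ξ * χ ξ) (reverse ψ)) =
      contractionOp σ μ (Function.swap u) (fun ξ => φ ξ * χ ξ) ψ := by
    funext n η
    simp only [reverse, contractionOp, contraction, phaseSum_comp_rev, Fin.rev_rev]
  rw [← hcontr]
  have h := (zAnn_zCreRight (σ := σ) hu.swap hχ hφ hψ.reverse).reverse
  simp only [zCreRight, conjByJ, reverse_add, reverse_reverse] at h
  exact h

theorem CompatiblePhases.commuteOnFinite_zField (h : CompatiblePhases μ c u w)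
    (hφ : MemLp φ 2 μ) (hφ' : MemLp φ' 2 μ) (hχ : MemLp χ 2 μ) (hχ' : MemLp χ' 2 μ)
    (hcontr : ∀ (n : ℕ) (η : Fin n → X),
      contraction μ (Function.swap u) (fun ξ => conj (φ (c ξ)) * χ' ξ) η =
        contraction μ u (fun ξ => χ ξ * conj (φ' (c ξ))) η) :
    CommuteOnFinite σ μ (conjByJ (modularJ c w) (zField σ μ u φ φ')) (zField σ μ u χ χ') := by
  have hu := h.measurable_phase
  have hJ (ψ : Wave X) : conjByJ (modularJ c w) (zField σ μ u φ φ') ψ =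
      zAnnRight μ (Function.swap u) (fun ξ => conj (φ (c ξ))) ψ +
        zCreRight σ (Function.swap u) (fun ξ => conj (φ' (c ξ))) ψ := by
    rw [← h.conjByJ_zAnn, ← h.conjByJ_zCre]
    exact modularJ_add c
  have hcφ : MemLp (fun ξ => conj (φ (c ξ))) 2 μ :=
    (hφ.comp_measurePreserving h.measurePreserving).star
  have hcφ' : MemLp (fun ξ => conj (φ' (c ξ))) 2 μ :=
    (hφ'.comp_measurePreserving h.measurePreserving).star
  intro ψ hfinite n
  have hψ : SquareIntegrable μ ψ := hfinite.memLp
  simp only [hJ, zField]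
  filter_upwards [zAnnRight_add hu.swap hcφ (hψ.zAnn hu hχ)
      (SquareIntegrable.zCre (σ := σ) hu hχ' hψ) n,
    zAnn_add hu hχ (hψ.zAnnRight hu.swap hcφ)
      (SquareIntegrable.zCreRight (σ := σ) hu.swap hcφ' hψ) n,
    zAnnRight_zAnn hu hcφ hχ hψ n, zAnnRight_zCre (σ := σ) hu hcφ hχ' hψ n,
    zAnn_zCreRight (σ := σ) hu hcφ' hχ hψ n] with η hright hleft hann hcre hcre'
  simp only [Pi.add_apply, contractionOp] at hright hleft hcre hcre'
  simp only [Pi.add_apply, hright, hleft, hann, hcre, hcre', zCreRight_add, zCre_add,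
    zCreRight_zCre, hcontr]
  ring

theorem CompatiblePhases.commuteOnFinite_zSharp (h : CompatiblePhases μ c u w)
    (hφ : MemLp φ 2 μ) (hχ : MemLp χ 2 μ) (hdisjoint : ∀ ξ, φ (c ξ) = 0 ∨ χ ξ = 0) (a b : Bool) :
    CommuteOnFinite σ μ (conjByJ (modularJ c w) (zSharp σ μ u a φ)) (zSharp σ μ u b χ) := by
  have hu := h.measurable_phase
  have hcφ : MemLp (fun ξ => conj (φ (c ξ))) 2 μ :=
    (hφ.comp_measurePreserving h.measurePreserving).star
  have hzero (v : X → X → ℝ) {ρ : X → ℂ} (hρ : ∀ ξ, ρ ξ = 0) (ψ : Wave X) :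
      contractionOp σ μ v ρ ψ = 0 := by
    funext n η
    simp [contractionOp, contraction, hρ]
  have hφχ (ξ : X) : conj (φ (c ξ)) * χ ξ = 0 := by
    rcases hdisjoint ξ with h | h <;> simp [h]
  intro ψ hfinite
  have hψ : SquareIntegrable μ ψ := hfinite.memLp
  cases a <;> cases b <;> simp only [zSharp, h.conjByJ_zAnn, h.conjByJ_zCre]
  · exact zAnnRight_zAnn hu hcφ hχ hψ
  · simpa only [hzero _ hφχ, add_zero] using zAnnRight_zCre (σ := σ) hu hcφ hχ hψ
  · have hχφ (ξ : X) : χ ξ * conj (φ (c ξ)) = 0 := by rw [mul_comm, hφχ]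
    intro n
    filter_upwards [zAnn_zCreRight (σ := σ) hu hcφ hχ hψ n] with η hη
    rw [hη, hzero _ hχφ, add_zero]
  · rw [zCreRight_zCre]
    exact fun n => .rfl

end SmearedCommutators

/-! ### Wave functions of test functions -/

section WaveFunctions

open Complex (I)

/-- The plane wave `exp (-i p(ζ) x)`, the integral kernel of `waveFn`. -/
def planeWave (m : ℝ) (ζ : ℂ) (x : ℝ × ℝ) : ℂ :=
  Complex.exp (-I * (m * (Complex.cosh ζ * (x.1 : ℂ) + Complex.sinh ζ * (x.2 : ℂ))))

/-- The complex rapidities for which the plane waves are bounded by one on the support of `f`, so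
that the integral defining the wave function of `f` converges. -/
def dampedRapidities (m : ℝ) (f : ℝ × ℝ → ℂ) : Set ℂ :=
  {ζ | ∀ x ∈ tsupport f, ‖planeWave m ζ x‖ ≤ 1}

lemma waveFn_eq_integral_planeWave (m : ℝ) (f : ℝ × ℝ → ℂ) (ζ : ℂ) :
    waveFn m f ζ = ((Real.sqrt (2 * Real.pi))⁻¹ : ℂ) * ∫ x, planeWave m ζ x * f x := rfl

lemma im_cosh (ζ : ℂ) : (Complex.cosh ζ).im = Real.sinh ζ.re * Real.sin ζ.im := by
  conv_lhs => rw [← Complex.re_add_im ζ, Complex.cosh_add, Complex.cosh_mul_I, Complex.sinh_mul_I]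
  simp [← Complex.ofReal_cosh, ← Complex.ofReal_sinh, ← Complex.ofReal_cos, ← Complex.ofReal_sin]

lemma im_sinh (ζ : ℂ) : (Complex.sinh ζ).im = Real.cosh ζ.re * Real.sin ζ.im := by
  conv_lhs => rw [← Complex.re_add_im ζ, Complex.sinh_add, Complex.cosh_mul_I, Complex.sinh_mul_I]
  simp [← Complex.ofReal_cosh, ← Complex.ofReal_sinh, ← Complex.ofReal_cos, ← Complex.ofReal_sin]

lemma abs_sinh_le_cosh (t : ℝ) : |Real.sinh t| ≤ Real.cosh t := by
  rw [abs_le]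
  constructor
  · linarith [Real.cosh_add_sinh t, Real.exp_pos t]
  · linarith [Real.cosh_sub_sinh t, Real.exp_pos (-t)]

lemma norm_planeWave (m : ℝ) (ζ : ℂ) (x : ℝ × ℝ) : ‖planeWave m ζ x‖ =
    Real.exp (m * Real.sin ζ.im * (Real.sinh ζ.re * x.1 + Real.cosh ζ.re * x.2)) := by
  rw [planeWave, Complex.norm_exp]
  congr 1
  simp only [neg_mul, Complex.neg_re, Complex.I_mul_re, Complex.im_ofReal_mul, Complex.add_im,
    Complex.im_mul_ofReal, im_cosh, im_sinh]
  ring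

lemma continuous_planeWave (m : ℝ) (ζ : ℂ) : Continuous (planeWave m ζ) := by
  unfold planeWave; fun_prop

lemma mem_dampedRapidities_of_sin_eq_zero (m : ℝ) (f : ℝ × ℝ → ℂ) {ζ : ℂ}
    (h : Real.sin ζ.im = 0) : ζ ∈ dampedRapidities m f := fun x _ => by
  simp [norm_planeWave, h]

lemma strip_subset_dampedRapidities {m : ℝ} (hm : 0 ≤ m) {f : ℝ × ℝ → ℂ}
    (hf : Function.support f ⊆ wedge) :
    Complex.im ⁻¹' Set.Icc (-Real.pi) 0 ⊆ dampedRapidities m f := by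
  intro ζ hζ x hx
  have hclosed : IsClosed {x : ℝ × ℝ | |x.1| ≤ x.2} := isClosed_le (by fun_prop) (by fun_prop)
  have hx' : |x.1| ≤ x.2 :=
    closure_minimal (fun y hy => (show |y.1| < y.2 from hf hy).le) hclosed hx
  have hsin : Real.sin ζ.im ≤ 0 := Real.sin_nonpos_of_nonpos_of_neg_pi_le hζ.2 hζ.1
  have habs : |Real.sinh ζ.re * x.1| ≤ Real.cosh ζ.re * x.2 := by
    rw [abs_mul]
    exact mul_le_mul (abs_sinh_le_cosh _) hx' (abs_nonneg _) (Real.cosh_pos _).le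
  rw [norm_planeWave, Real.exp_le_one_iff]
  refine mul_nonpos_of_nonpos_of_nonneg (mul_nonpos_of_nonneg_of_nonpos hm hsin) ?_
  linarith [neg_abs_le (Real.sinh ζ.re * x.1)]

lemma norm_planeWave_mul_le {m : ℝ} {f g : ℝ × ℝ → ℂ} {ζ : ℂ} (hζ : ζ ∈ dampedRapidities m f)
    (hg : Function.support g ⊆ tsupport f) (x : ℝ × ℝ) : ‖planeWave m ζ x * g x‖ ≤ ‖g x‖ := by
  by_cases hx : g x = 0
  · simp [hx]
  · rw [norm_mul]
    exact mul_le_of_le_one_left (norm_nonneg _) (hζ x (hg hx))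

lemma integrable_planeWave_mul {m : ℝ} {f : ℝ × ℝ → ℂ} (g : 𝓢(ℝ × ℝ, ℂ)) {ζ : ℂ}
    (hζ : ζ ∈ dampedRapidities m f) (hg : Function.support g ⊆ tsupport f) :
    Integrable fun x => planeWave m ζ x * g x :=
  g.integrable.mono ((continuous_planeWave m ζ).mul g.continuous).aestronglyMeasurable
    (.of_forall (norm_planeWave_mul_le hζ hg))

lemma continuousOn_waveFn (m : ℝ) (f : 𝓢(ℝ × ℝ, ℂ)) :
    ContinuousOn (waveFn m f) (dampedRapidities m f) := by
  refine ContinuousOn.mul continuousOn_const ?_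
  refine continuousOn_of_dominated (F := fun ζ x => planeWave m ζ x * f x)
    (fun ζ _ => ((continuous_planeWave m ζ).mul f.continuous).aestronglyMeasurable)
    (fun ζ hζ => .of_forall (norm_planeWave_mul_le hζ subset_closure)) f.integrable.norm
    (.of_forall fun x => ?_)
  unfold planeWave
  fun_prop

lemma hasDerivAt_planeWave (m : ℝ) (ζ : ℂ) (x : ℝ × ℝ) :
    HasDerivAt (fun ζ => planeWave m ζ x)
      (planeWave m ζ x * (-I * (m * (Complex.sinh ζ * x.1 + Complex.cosh ζ * x.2)))) ζ :=
  (((((Complex.hasDerivAt_cosh ζ).mul_const _).add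
    ((Complex.hasDerivAt_sinh ζ).mul_const _)).const_mul _).const_mul _).cexp

lemma norm_mul_sinh_add_cosh_le {m M : ℝ} {ζ : ℂ} (hs : ‖Complex.sinh ζ‖ ≤ M)
    (hc : ‖Complex.cosh ζ‖ ≤ M) (x : ℝ × ℝ) :
    ‖-I * (m * (Complex.sinh ζ * (x.1 : ℂ) + Complex.cosh ζ * (x.2 : ℂ)))‖ ≤
      |m| * (M + M) * ‖x‖ := by
  have hM : 0 ≤ M := (norm_nonneg _).trans hs
  have hsum : ‖Complex.sinh ζ * (x.1 : ℂ) + Complex.cosh ζ * (x.2 : ℂ)‖ ≤ (M + M) * ‖x‖ := by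
    refine (norm_add_le _ _).trans ?_
    rw [norm_mul, norm_mul, Complex.norm_real, Complex.norm_real, add_mul]
    gcongr
    exacts [norm_fst_le x, norm_snd_le x]
  rw [norm_mul, norm_neg, Complex.norm_I, one_mul, norm_mul, Complex.norm_real, Real.norm_eq_abs,
    mul_assoc]
  gcongr

lemma differentiableOn_waveFn (m : ℝ) (f : 𝓢(ℝ × ℝ, ℂ)) :
    DifferentiableOn ℂ (waveFn m f) (interior (dampedRapidities m f)) := by
  intro ζ₀ hζ₀
  refine DifferentiableAt.differentiableWithinAt (DifferentiableAt.const_mul ?_ _)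
  obtain ⟨M, hM⟩ := (isCompact_closedBall ζ₀ (1 : ℝ)).exists_bound_of_continuousOn
    (f := fun ζ => (Complex.sinh ζ, Complex.cosh ζ)) (by fun_prop)
  refine (hasDerivAt_integral_of_dominated_loc_of_deriv_le
    (F := fun ζ x => planeWave m ζ x * f x) (bound := fun x => |m| * (M + M) * (‖x‖ ^ 1 * ‖f x‖))
    (Filter.inter_mem (isOpen_interior.mem_nhds hζ₀) (Metric.closedBall_mem_nhds ζ₀ one_pos))
    (.of_forall fun ζ => ((continuous_planeWave m ζ).mul f.continuous).aestronglyMeasurable)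
    (integrable_planeWave_mul f (interior_subset hζ₀) subset_closure) ?_
    (.of_forall fun x ζ hζ => ?_) ((f.integrable_pow_mul volume 1).const_mul _)
    (.of_forall fun x ζ _ => (hasDerivAt_planeWave m ζ x).mul_const _)).2.differentiableAt
  · refine Continuous.aestronglyMeasurable (((continuous_planeWave m ζ₀).mul ?_).mul f.continuous)
    fun_prop
  · have hdamped := norm_planeWave_mul_le (interior_subset hζ.1) subset_closure x
    have hpoly := norm_mul_sinh_add_cosh_le (m := m) ((norm_fst_le _).trans (hM ζ hζ.2))
      ((norm_snd_le _).trans (hM ζ hζ.2)) x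
    rw [mul_right_comm, norm_mul]
    calc _ ≤ ‖f x‖ * (|m| * (M + M) * ‖x‖) :=
          mul_le_mul hdamped hpoly (norm_nonneg _) (norm_nonneg _)
      _ = _ := by ring

lemma hasLineDerivAt_planeWave (m : ℝ) (ζ : ℂ) (x v : ℝ × ℝ) :
    HasLineDerivAt ℝ (planeWave m ζ)
      (-I * (m * (Complex.cosh ζ * v.1 + Complex.sinh ζ * v.2)) * planeWave m ζ x) x v := by
  have hline (a b : ℝ) : HasDerivAt (fun t : ℝ => ((a + t * b : ℝ) : ℂ)) b 0 := by
    simpa using (((hasDerivAt_id (0 : ℝ)).mul_const b).const_add a).ofReal_comp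
  have hexponent := ((((hline x.1 v.1).const_mul (Complex.cosh ζ)).add
    ((hline x.2 v.2).const_mul (Complex.sinh ζ))).const_mul (m : ℂ)).const_mul (-I)
  refine hexponent.cexp.congr_deriv ?_
  simp only [planeWave, Pi.add_apply, zero_mul, add_zero]
  ring

lemma integral_planeWave_mul_lineDeriv (m : ℝ) (f : 𝓢(ℝ × ℝ, ℂ)) {ζ : ℂ}
    (hζ : ζ ∈ dampedRapidities m f) (v : ℝ × ℝ) :
    ∫ x, planeWave m ζ x * LineDeriv.lineDerivOp v f x =
      I * (m * (Complex.cosh ζ * v.1 + Complex.sinh ζ * v.2)) * ∫ x, planeWave m ζ x * f x := by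
  have hint := integrable_planeWave_mul f hζ subset_closure
  have hint' := integrable_planeWave_mul (LineDeriv.lineDerivOp v f) hζ
    (subset_closure.trans (SchwartzMap.tsupport_lineDerivOp_subset _ f))
  have hparts := integral_bilinear_hasLineDerivAt_right_eq_neg_left_of_integrable (μ := volume)
    (B := ContinuousLinearMap.mul ℝ ℂ) (v := v)
    (by
      simpa only [ContinuousLinearMap.mul_apply', mul_assoc] using
        hint.const_mul (-I * (m * (Complex.cosh ζ * v.1 + Complex.sinh ζ * v.2))))
    hint' hint (fun x _ => hasLineDerivAt_planeWave m ζ x v)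
    (fun x _ => by
      rw [SchwartzMap.lineDerivOp_apply_eq_fderiv]
      exact (f.hasFDerivAt x).hasLineDerivAt v)
  simp only [ContinuousLinearMap.mul_apply'] at hparts
  simp only [hparts, mul_assoc, integral_const_mul]
  ring

lemma norm_waveFn_mul_le (m : ℝ) (f : 𝓢(ℝ × ℝ, ℂ)) {ζ : ℂ} (hζ : ζ ∈ dampedRapidities m f)
    (v : ℝ × ℝ) :
    |m| * ‖Complex.cosh ζ * v.1 + Complex.sinh ζ * v.2‖ * ‖waveFn m f ζ‖ ≤
      (Real.sqrt (2 * Real.pi))⁻¹ * ∫ x, ‖LineDeriv.lineDerivOp v f x‖ := by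
  have hbound : ‖∫ x, planeWave m ζ x * LineDeriv.lineDerivOp v f x‖ ≤
      ∫ x, ‖LineDeriv.lineDerivOp v f x‖ :=
    norm_integral_le_of_norm_le (SchwartzMap.integrable _).norm (.of_forall
      (norm_planeWave_mul_le hζ
        (subset_closure.trans (SchwartzMap.tsupport_lineDerivOp_subset _ f))))
  rw [integral_planeWave_mul_lineDeriv m f hζ, norm_mul, norm_mul, Complex.norm_I, one_mul,
    norm_mul, Complex.norm_real, Real.norm_eq_abs] at hbound
  rw [waveFn_eq_integral_planeWave, norm_mul, norm_inv, Complex.norm_real,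
    Real.norm_of_nonneg (Real.sqrt_nonneg _), mul_left_comm]
  gcongr

/- In the lightlike directions `(1, ±1)` the momentum is `m exp (±ζ)`, so that one integration by
parts already gives exponential decay. -/
lemma exists_norm_waveFn_le {m : ℝ} (hm : m ≠ 0) (f : 𝓢(ℝ × ℝ, ℂ)) :
    ∃ C : ℝ, 0 ≤ C ∧ ∀ ζ ∈ dampedRapidities m f, ‖waveFn m f ζ‖ ≤ C * Real.exp (-|ζ.re|) := by
  set K : ℝ × ℝ → ℝ := fun v =>
    (Real.sqrt (2 * Real.pi))⁻¹ * ∫ x, ‖LineDeriv.lineDerivOp v f x‖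
  have hK0 (v) : 0 ≤ K v := mul_nonneg (by positivity) (integral_nonneg fun _ => norm_nonneg _)
  have hm' : 0 < |m| := abs_pos.2 hm
  refine ⟨(K (1, 1) + K (1, -1)) / |m|, div_nonneg (add_nonneg (hK0 _) (hK0 _)) hm'.le,
    fun ζ hζ => ?_⟩
  have hplus := norm_waveFn_mul_le m f hζ (1, 1)
  have hminus := norm_waveFn_mul_le m f hζ (1, -1)
  simp only [Complex.ofReal_one, Complex.ofReal_neg, mul_one, mul_neg, ← sub_eq_add_neg,
    Complex.cosh_add_sinh, Complex.cosh_sub_sinh, Complex.norm_exp, Complex.neg_re]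
    at hplus hminus
  have hsum : |m| * Real.exp |ζ.re| * ‖waveFn m f ζ‖ ≤ K (1, 1) + K (1, -1) := by
    rcases abs_cases ζ.re with ⟨h, _⟩ | ⟨h, _⟩ <;> rw [h]
    · linarith [hK0 (1, -1)]
    · linarith [hK0 (1, 1)]
  rw [Real.exp_neg, div_mul_eq_mul_div, le_div_iff₀ hm', ← div_eq_mul_inv,
    le_div_iff₀ (Real.exp_pos _)]
  linarith

lemma exp_neg_abs_sq_le (t : ℝ) : Real.exp (-|t|) ^ 2 ≤ (1 + t ^ 2)⁻¹ := by
  rw [Real.exp_neg, inv_pow]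
  refine inv_anti₀ (by positivity) ?_
  have hsq := pow_le_pow_left₀ (by positivity) (Real.add_one_le_exp |t|) 2
  nlinarith [sq_abs t, abs_nonneg t]

lemma memLp_waveFn_comp {m : ℝ} (hm : m ≠ 0) (f : 𝓢(ℝ × ℝ, ℂ)) {a : ℝ → ℂ} (ha : Continuous a)
    (hre : ∀ θ, (a θ).re = θ) (hdamped : ∀ θ, a θ ∈ dampedRapidities m f) :
    MemLp (fun θ => waveFn m f (a θ)) 2 := by
  obtain ⟨C, -, hC⟩ := exists_norm_waveFn_le hm f
  have hcont : Continuous fun θ => waveFn m f (a θ) :=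
    (continuousOn_waveFn m f).comp_continuous ha hdamped
  rw [memLp_two_iff_integrable_sq_norm hcont.aestronglyMeasurable]
  refine (integrable_inv_one_add_sq.const_mul (C ^ 2)).mono'
    (hcont.norm.pow 2).aestronglyMeasurable (.of_forall fun θ => ?_)
  rw [Real.norm_of_nonneg (by positivity)]
  calc ‖waveFn m f (a θ)‖ ^ 2 ≤ (C * Real.exp (-|θ|)) ^ 2 := by
        gcongr
        simpa only [hre] using hC _ (hdamped θ)
    _ = C ^ 2 * Real.exp (-|θ|) ^ 2 := mul_pow _ _ _
    _ ≤ C ^ 2 * (1 + θ ^ 2)⁻¹ := by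
        gcongr
        exact exp_neg_abs_sq_le θ

lemma memLp_waveFn {m : ℝ} (hm : m ≠ 0) (f : 𝓢(ℝ × ℝ, ℂ)) :
    MemLp (fun θ : ℝ => waveFn m f θ) 2 :=
  memLp_waveFn_comp hm f Complex.continuous_ofReal Complex.ofReal_re
    fun _ => mem_dampedRapidities_of_sin_eq_zero m f (by simp)

lemma memLp_waveFn_sub_pi {m : ℝ} (hm : m ≠ 0) (f : 𝓢(ℝ × ℝ, ℂ)) :
    MemLp (fun θ : ℝ => waveFn m f (θ - Real.pi * I)) 2 :=
  memLp_waveFn_comp hm f (by fun_prop) (fun θ => by simp)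
    fun _ => mem_dampedRapidities_of_sin_eq_zero m f (by simp)

lemma planeWave_conj_sub_pi (m : ℝ) (ζ : ℂ) (x : ℝ × ℝ) :
    planeWave m (ζ - Real.pi * I) x = conj (planeWave m (conj ζ) x) := by
  rw [planeWave, planeWave, ← Complex.exp_conj, Complex.cosh_sub, Complex.sinh_sub,
    Complex.cosh_mul_I, Complex.sinh_mul_I, ← Complex.ofReal_cos, ← Complex.ofReal_sin]
  simp only [Real.cos_pi, Real.sin_pi, map_mul, map_neg, map_add, Complex.conj_I,
    Complex.conj_ofReal, ← Complex.cosh_conj, ← Complex.sinh_conj, Complex.conj_conj]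
  congr 1
  push_cast
  ring

lemma waveFn_conj_sub_pi (m : ℝ) (f : ℝ × ℝ → ℂ) (ζ : ℂ) :
    waveFn m (fun x => conj (f x)) (ζ - Real.pi * I) = conj (waveFn m f (conj ζ)) := by
  simp only [waveFn_eq_integral_planeWave, planeWave_conj_sub_pi, map_mul, ← integral_conj,
    map_inv₀, Complex.conj_ofReal]

lemma waveFn_conj (m : ℝ) (f : ℝ × ℝ → ℂ) (ζ : ℂ) :
    waveFn m (fun x => conj (f x)) ζ = conj (waveFn m f (conj ζ - Real.pi * I)) := by
  have h := waveFn_conj_sub_pi m (fun x => conj (f x)) (conj ζ)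
  simp only [Complex.conj_conj] at h
  rw [h, Complex.conj_conj]

lemma waveFn_sub_pi_of_real (m : ℝ) {f : ℝ × ℝ → ℂ} (hf : ∀ x, (f x).im = 0) (θ : ℝ) :
    waveFn m f (θ - Real.pi * I) = conj (waveFn m f θ) := by
  have h := waveFn_conj_sub_pi m f θ
  simpa only [Complex.conj_eq_iff_im.2 (hf _), Complex.conj_ofReal] using h

end WaveFunctions

/-! ### Shifting the contour -/

section Contour

open Complex (I)
open Filter Topology Set

section Strip

variable {E : Type*} [NormedAddCommGroup E] {F : ℂ → E} {b : ℝ} {bound : ℝ → ℝ}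

lemma integrable_horizontal_of_strip_bound (hc : ContinuousOn F (Complex.im ⁻¹' Icc 0 b))
    (hint : Integrable bound) (hbound : ∀ ζ ∈ Complex.im ⁻¹' Icc 0 b, ‖F ζ‖ ≤ bound ζ.re)
    {t : ℝ} (ht : t ∈ Icc 0 b) : Integrable fun θ : ℝ => F (θ + t * I) := by
  have hmem (θ : ℝ) : (θ + t * I : ℂ) ∈ Complex.im ⁻¹' Icc 0 b := by simpa using ht
  have hcont : Continuous fun θ : ℝ => F (θ + t * I) := hc.comp_continuous (by fun_prop) hmem
  exact hint.mono' hcont.aestronglyMeasurable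
    (.of_forall fun θ => by simpa using hbound _ (hmem θ))

variable [NormedSpace ℂ E]

lemma tendsto_vertical_of_strip_bound (hb : 0 ≤ b)
    (hbound : ∀ ζ ∈ Complex.im ⁻¹' Icc 0 b, ‖F ζ‖ ≤ bound ζ.re) {l : Filter ℝ}
    (hlim : Tendsto bound l (𝓝 0)) :
    Tendsto (fun R : ℝ => ∫ y in (0 : ℝ)..b, F (R + y * I)) l (𝓝 0) := by
  refine squeeze_zero_norm (fun R => ?_) (by simpa using hlim.mul_const b)
  have h := intervalIntegral.norm_integral_le_of_norm_le_const (a := 0) (b := b)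
    (f := fun y : ℝ => F (R + y * I)) (C := bound R) fun y hy => by
      rw [uIoc_of_le hb] at hy
      simpa using hbound (R + y * I) (by simpa using Ioc_subset_Icc_self hy)
  rwa [sub_zero, abs_of_nonneg hb] at h

lemma integral_boundary_strip_rect_eq_zero (hb : 0 ≤ b)
    (hc : ContinuousOn F (Complex.im ⁻¹' Icc 0 b))
    (hd : DifferentiableOn ℂ F (Complex.im ⁻¹' Ioo 0 b)) (R : ℝ) :
    (∫ θ in -R..R, F (θ + (0 : ℝ) * I)) - (∫ θ in -R..R, F (θ + b * I)) +
      I • (∫ y in (0 : ℝ)..b, F (R + y * I)) -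
      I • (∫ y in (0 : ℝ)..b, F ((-R : ℝ) + y * I)) = 0 := by
  have h := Complex.integral_boundary_rect_eq_zero_of_continuousOn_of_differentiableOn F
    (-R : ℝ) (R + b * I)
    (hc.mono fun ζ hζ => by simpa [uIcc_of_le hb] using hζ.2)
    (hd.mono fun ζ hζ => by simpa [hb] using hζ.2)
  simpa using h

lemma integral_eq_integral_add_mul_I (hb : 0 ≤ b)
    (hc : ContinuousOn F (Complex.im ⁻¹' Icc 0 b))
    (hd : DifferentiableOn ℂ F (Complex.im ⁻¹' Ioo 0 b)) (hint : Integrable bound)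
    (hlim : Tendsto bound (cocompact ℝ) (𝓝 0))
    (hbound : ∀ ζ ∈ Complex.im ⁻¹' Icc 0 b, ‖F ζ‖ ≤ bound ζ.re) :
    ∫ θ : ℝ, F θ = ∫ θ : ℝ, F (θ + b * I) := by
  have hbottom := intervalIntegral_tendsto_integral
    (integrable_horizontal_of_strip_bound hc hint hbound (left_mem_Icc.2 hb))
    tendsto_neg_atTop_atBot tendsto_id
  have htop := intervalIntegral_tendsto_integral
    (integrable_horizontal_of_strip_bound hc hint hbound (right_mem_Icc.2 hb))
    tendsto_neg_atTop_atBot tendsto_id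
  have hright := tendsto_vertical_of_strip_bound hb hbound (hlim.mono_left atTop_le_cocompact)
  have hleft := (tendsto_vertical_of_strip_bound hb hbound
    (hlim.mono_left atBot_le_cocompact)).comp tendsto_neg_atTop_atBot
  have hrect := ((hbottom.sub htop).add (hright.const_smul I)).sub (hleft.const_smul I)
  simp only [id, Function.comp_apply, integral_boundary_strip_rect_eq_zero hb hc hd, smul_zero,
    add_zero, sub_zero] at hrect
  simpa [sub_eq_zero] using tendsto_nhds_unique hrect tendsto_const_nhds

end Strip

lemma tendsto_inv_one_add_sq_cocompact :
    Tendsto (fun t : ℝ => (1 + t ^ 2)⁻¹) (cocompact ℝ) (𝓝 0) := by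
  have hsq : Tendsto (fun t : ℝ => t ^ 2) (cocompact ℝ) atTop := by
    simpa only [Function.comp_def, Real.norm_eq_abs, sq_abs] using
      (tendsto_pow_atTop two_ne_zero).comp (tendsto_norm_cocompact_atTop (E := ℝ))
  exact (tendsto_atTop_add_const_left _ _ hsq).inv_tendsto_atTop

lemma sub_pi_mem_dampedRapidities {m : ℝ} (hm : 0 ≤ m) {f : ℝ × ℝ → ℂ}
    (hf : Function.support f ⊆ wedge) :
    MapsTo (fun ζ : ℂ => ζ - Real.pi * I) (Complex.im ⁻¹' Icc 0 Real.pi)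
      (dampedRapidities m f) := fun ζ hζ =>
  strip_subset_dampedRapidities hm hf (by simpa using hζ)

lemma continuousOn_waveFn_sub_pi {m : ℝ} (hm : 0 ≤ m) {f : 𝓢(ℝ × ℝ, ℂ)}
    (hf : Function.support f ⊆ wedge) :
    ContinuousOn (fun ζ => waveFn m f (ζ - Real.pi * I)) (Complex.im ⁻¹' Icc 0 Real.pi) :=
  (continuousOn_waveFn m f).comp (by fun_prop) (sub_pi_mem_dampedRapidities hm hf)

lemma differentiableOn_waveFn_sub_pi {m : ℝ} (hm : 0 ≤ m) {f : 𝓢(ℝ × ℝ, ℂ)}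
    (hf : Function.support f ⊆ wedge) :
    DifferentiableOn ℂ (fun ζ => waveFn m f (ζ - Real.pi * I)) (Complex.im ⁻¹' Ioo 0 Real.pi) := by
  have hopen : IsOpen (Complex.im ⁻¹' Ioo (-Real.pi) 0) :=
    isOpen_Ioo.preimage Complex.continuous_im
  have hinterior := interior_maximal
    ((preimage_mono Ioo_subset_Icc_self).trans (strip_subset_dampedRapidities hm hf)) hopen
  exact (differentiableOn_waveFn m f).comp (by fun_prop)
    fun ζ hζ => hinterior (by simpa using hζ)

lemma exists_norm_mul_waveFn_sub_pi_le {m : ℝ} (hm : 0 < m) {f g : 𝓢(ℝ × ℝ, ℂ)}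
    (hf : Function.support f ⊆ wedge) (hg : Function.support g ⊆ wedge) :
    ∃ C : ℝ, 0 ≤ C ∧ ∀ ζ ∈ Complex.im ⁻¹' Icc 0 Real.pi,
      ‖waveFn m f (ζ - Real.pi * I) * waveFn m g (ζ - Real.pi * I)‖ ≤ C * (1 + ζ.re ^ 2)⁻¹ := by
  obtain ⟨Cf, hCf, hf'⟩ := exists_norm_waveFn_le hm.ne' f
  obtain ⟨Cg, hCg, hg'⟩ := exists_norm_waveFn_le hm.ne' g
  refine ⟨Cf * Cg, by positivity, fun ζ hζ => ?_⟩
  have hre : (ζ - Real.pi * I).re = ζ.re := by simp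
  rw [norm_mul]
  calc _ ≤ Cf * Real.exp (-|ζ.re|) * (Cg * Real.exp (-|ζ.re|)) := by
        gcongr
        · simpa only [hre] using hf' _ (sub_pi_mem_dampedRapidities hm.le hf hζ)
        · simpa only [hre] using hg' _ (sub_pi_mem_dampedRapidities hm.le hg hζ)
    _ = Cf * Cg * Real.exp (-|ζ.re|) ^ 2 := by ring
    _ ≤ Cf * Cg * (1 + ζ.re ^ 2)⁻¹ := by
        gcongr
        exact exp_neg_abs_sq_le ζ.re

lemma integral_waveFn_crossing {m : ℝ} (hm : 0 < m) {f g : 𝓢(ℝ × ℝ, ℂ)}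
    (hf : Function.support f ⊆ wedge) (hg : Function.support g ⊆ wedge) {H : ℂ → ℂ} {B : ℝ}
    (hc : ContinuousOn H (Complex.im ⁻¹' Icc 0 Real.pi))
    (hd : DifferentiableOn ℂ H (Complex.im ⁻¹' Ioo 0 Real.pi))
    (hb : ∀ ζ ∈ Complex.im ⁻¹' Icc 0 Real.pi, ‖H ζ‖ ≤ B) :
    ∫ θ : ℝ, waveFn m f (θ - Real.pi * I) * waveFn m g (θ - Real.pi * I) * H θ =
      ∫ θ : ℝ, waveFn m f θ * waveFn m g θ * H (θ + Real.pi * I) := by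
  obtain ⟨C, hC, hfg⟩ := exists_norm_mul_waveFn_sub_pi_le hm hf hg
  have hshift := integral_eq_integral_add_mul_I
    (F := fun ζ => waveFn m f (ζ - Real.pi * I) * waveFn m g (ζ - Real.pi * I) * H ζ)
    (bound := fun t => C * (1 + t ^ 2)⁻¹ * B) Real.pi_pos.le
    (((continuousOn_waveFn_sub_pi hm.le hf).mul (continuousOn_waveFn_sub_pi hm.le hg)).mul hc)
    (((differentiableOn_waveFn_sub_pi hm.le hf).mul
      (differentiableOn_waveFn_sub_pi hm.le hg)).mul hd)
    ((integrable_inv_one_add_sq.const_mul C).mul_const B)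
    (by simpa using (tendsto_inv_one_add_sq_cocompact.const_mul C).mul_const B)
    (fun ζ hζ => by
      rw [norm_mul]
      exact mul_le_mul (hfg ζ hζ) (hb ζ hζ) (norm_nonneg _) (by positivity))
  simpa only [add_sub_cancel_right] using hshift

/-- The complex conjugate of a test function. -/
def conjTestFunction (f : 𝓢(ℝ × ℝ, ℂ)) : 𝓢(ℝ × ℝ, ℂ) :=
  SchwartzMap.postcompCLM (𝕜 := ℝ) (Complex.conjCLE : ℂ →L[ℝ] ℂ) f

lemma coe_conjTestFunction (f : 𝓢(ℝ × ℝ, ℂ)) : ⇑(conjTestFunction f) = fun x => conj (f x) := by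
  funext x
  simp [conjTestFunction]

/- The conjugate wave function of `f` at `θ` is the analytic wave function of the conjugate of `f`
at `θ - iπ`. -/
lemma integral_conj_waveFn_crossing {m : ℝ} (hm : 0 < m) {f g : 𝓢(ℝ × ℝ, ℂ)}
    (hf : Function.support f ⊆ wedge) (hg : Function.support g ⊆ wedge) {H : ℂ → ℂ} {B : ℝ}
    (hc : ContinuousOn H (Complex.im ⁻¹' Icc 0 Real.pi))
    (hd : DifferentiableOn ℂ H (Complex.im ⁻¹' Ioo 0 Real.pi))
    (hb : ∀ ζ ∈ Complex.im ⁻¹' Icc 0 Real.pi, ‖H ζ‖ ≤ B) :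
    ∫ θ : ℝ, conj (waveFn m f θ) * waveFn m g (θ - Real.pi * I) * H θ =
      ∫ θ : ℝ, waveFn m g θ * conj (waveFn m f (θ - Real.pi * I)) * H (θ + Real.pi * I) := by
  have hconj : Function.support (conjTestFunction f) ⊆ wedge := fun x hx =>
    hf fun h0 => hx (by simp [coe_conjTestFunction, h0])
  have h := integral_waveFn_crossing hm hconj hg hc hd hb
  simp only [coe_conjTestFunction, waveFn_conj_sub_pi] at h
  simp only [waveFn_conj m f, Complex.conj_ofReal] at h
  rw [h]
  simp only [mul_comm (conj _)]

end Contour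

/-! ### One self-conjugate particle -/

section Scalar

open Complex (I)

variable {ϑ : ℝ → ℝ} {S : ℂ → ℂ} {n : ℕ}

lemma ae_forall_ne {ι : Type*} [Countable ι] (η : ι → ℝ) : ∀ᵐ θ : ℝ, ∀ j, θ ≠ η j :=
  ae_all_iff.2 fun j => by simp [ae_iff]

lemma coe_circleExp_phaseSum_sub {X : Type} (v u : X → X → ℝ) (ξ : X) (η : Fin n → X) :
    (Circle.exp (phaseSum v ξ η - phaseSum u ξ η) : ℂ) =
      ∏ j, (Circle.exp (v ξ (η j) - u ξ (η j)) : ℂ) := by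
  simp only [Circle.coe_exp, phaseSum, ← Complex.exp_sum, ← Finset.sum_mul,
    ← Complex.ofReal_sum, Finset.sum_sub_distrib]

namespace IsTwoParticleS

lemma circleExp_phaseBelow_sub (h : IsTwoParticleS ϑ S) {a b : ℝ} (hab : a ≠ b) :
    (Circle.exp (phaseBelow ϑ a b - phaseBelow ϑ b a) : ℂ) = S (a - b) := by
  unfold phaseBelow
  rcases lt_or_gt_of_ne hab with hlt | hgt
  · have hunitary := h.unitary (b - a)
    rw [h.phase, exp_I_mul_ofReal, ← Complex.ofReal_neg, neg_sub] at hunitary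
    rw [if_neg hlt.not_gt, if_pos hlt, zero_sub, Circle.exp_neg, Circle.coe_inv,
      ← Complex.ofReal_sub]
    exact inv_eq_of_mul_eq_one_right hunitary
  · rw [if_pos hgt, if_neg hgt.not_gt, sub_zero, ← exp_I_mul_ofReal, ← h.phase,
      Complex.ofReal_sub]

lemma circleExp_phaseSum_sub (h : IsTwoParticleS ϑ S) {θ : ℝ} {η : Fin n → ℝ}
    (hθ : ∀ j, θ ≠ η j) :
    (Circle.exp (phaseSum (phaseBelow ϑ) θ η - phaseSum (Function.swap (phaseBelow ϑ)) θ η) : ℂ) =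
      ∏ j, S (θ - η j) := by
  rw [coe_circleExp_phaseSum_sub]
  exact Finset.prod_congr rfl fun j _ => h.circleExp_phaseBelow_sub (hθ j)

lemma circleExp_phaseSum_swap_sub (h : IsTwoParticleS ϑ S) {θ : ℝ} {η : Fin n → ℝ}
    (hθ : ∀ j, θ ≠ η j) :
    (Circle.exp (phaseSum (Function.swap (phaseBelow ϑ)) θ η - phaseSum (phaseBelow ϑ) θ η) : ℂ) =
      ∏ j, S (θ + Real.pi * I - η j) := by
  rw [coe_circleExp_phaseSum_sub]
  refine Finset.prod_congr rfl fun j _ => ?_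
  have hcrossing := h.crossing (θ - η j)
  rw [Complex.ofReal_sub, neg_sub, ← add_sub_right_comm] at hcrossing
  rw [hcrossing]
  exact h.circleExp_phaseBelow_sub (hθ j).symm

lemma measurablePhase_phaseBelow (h : IsTwoParticleS ϑ S) : MeasurablePhase (phaseBelow ϑ) := by
  have hS : Continuous fun θ : ℝ => S θ :=
    h.continuousOn.comp_continuous Complex.continuous_ofReal fun θ => by simp [Real.pi_pos.le]
  have hcases : (fun z : ℝ × ℝ => (Circle.exp (phaseBelow ϑ z.1 z.2) : ℂ)) =
      fun z => if z.2 < z.1 then S ((z.1 - z.2 : ℝ) : ℂ) else 1 := by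
    funext z
    split_ifs with hz
    · rw [phaseBelow, if_pos hz, h.phase, exp_I_mul_ofReal]
    · simp [phaseBelow, hz]
  rw [MeasurablePhase, hcases]
  exact Measurable.ite (measurableSet_lt measurable_snd measurable_fst)
    (hS.measurable.comp (measurable_fst.sub measurable_snd)) measurable_const

lemma compatiblePhases (h : IsTwoParticleS ϑ S) :
    CompatiblePhases volume id (phaseBelow ϑ) (phaseBelow ϑ) where
  involutive _ := rfl
  measurePreserving := .id _
  diag ξ := by simp [phaseBelow]
  pair _ _ := rfl
  conj_phase _ _ := rfl
  conj_scattering _ _ := rfl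
  measurable_phase := h.measurablePhase_phaseBelow
  measurable_scattering := h.measurablePhase_phaseBelow

lemma contraction_crossing (h : IsTwoParticleS ϑ S) {m : ℝ} (hm : 0 < m) {f g : 𝓢(ℝ × ℝ, ℂ)}
    (hf : Function.support f ⊆ wedge) (hg : Function.support g ⊆ wedge) (η : Fin n → ℝ) :
    contraction volume (Function.swap (phaseBelow ϑ))
        (fun θ => conj (waveFn m f θ) * waveFn m g (θ - Real.pi * I)) η =
      contraction volume (phaseBelow ϑ)
        (fun θ => waveFn m g θ * conj (waveFn m f (θ - Real.pi * I))) η := by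
  obtain ⟨B, hB⟩ := h.bounded
  have hcrossing := integral_conj_waveFn_crossing hm hf hg (H := fun ζ => ∏ j, S (ζ - η j))
    (B := ∏ _j : Fin n, B)
    (continuousOn_finsetProd _ fun j _ => h.continuousOn.comp (by fun_prop)
      fun ζ hζ => by simpa using hζ)
    (DifferentiableOn.fun_finsetProd fun j _ => h.differentiableOn.comp (by fun_prop)
      fun ζ hζ => by simpa using hζ)
    (fun ζ hζ => by
      rw [norm_prod]
      exact Finset.prod_le_prod (fun _ _ => norm_nonneg _)
        fun j _ => hB _ (by simpa using hζ.1) (by simpa using hζ.2))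
  have hleft := integral_congr_ae ((ae_forall_ne η).mono fun θ hθ => congrArg
    (conj (waveFn m f θ) * waveFn m g (θ - Real.pi * I) * ·) (h.circleExp_phaseSum_sub hθ))
  have hright := integral_congr_ae ((ae_forall_ne η).mono fun θ hθ => congrArg
    (waveFn m g θ * conj (waveFn m f (θ - Real.pi * I)) * ·) (h.circleExp_phaseSum_swap_sub hθ))
  exact hleft.trans (hcrossing.trans hright.symm)

lemma isHermitianConj_scalarZ (h : IsTwoParticleS ϑ S) {m : ℝ} (hm : m ≠ 0) (f : 𝓢(ℝ × ℝ, ℂ)) :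
    IsHermitianConj .bose volume (scalarZ m ϑ f) (scalarZ m ϑ fun x => conj (f x)) := by
  have hconj : (scalarZ m ϑ fun x => conj (f x)) = zField .bose volume (phaseBelow ϑ)
      (fun θ : ℝ => conj (waveFn m f (θ - Real.pi * I)))
      (fun θ : ℝ => conj (waveFn m f θ)) := by
    funext ψ
    simp only [scalarZ, zField, waveFn_conj_sub_pi]
    simp only [waveFn_conj, Complex.conj_ofReal]
  rw [hconj]
  exact isHermitianConj_zField h.measurablePhase_phaseBelow (memLp_waveFn hm f)
    (memLp_waveFn_sub_pi hm f)

end IsTwoParticleS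

lemma scalarZ_vacuum (m : ℝ) (ϑ : ℝ → ℝ) (f : ℝ × ℝ → ℂ) :
    scalarZ m ϑ f vacuum =
      creation .bose (fun θ : ℝ => waveFn m f (θ - Real.pi * I)) vacuum := by
  have hann : zAnn volume (phaseBelow ϑ) (fun θ => waveFn m f θ) vacuum = 0 := by
    funext n η
    simp [zAnn, zPoint, annihilate, expDensity, vacuum]
  rw [scalarZ, hann, zero_add, creation]
  funext n η
  match n with
  | 0 => rfl
  | 1 => simp [zCre, phaseBelow]
  | n + 2 => simp [zCre, vacuum]

end Scalar

/-! ### The Federbush model -/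

section Federbush

open Complex (I)

variable {s s' : Fin 2} {q q' : Bool} {n : ℕ}

instance : SigmaFinite fedMeasure := by
  unfold fedMeasure; infer_instance

lemma fedMeasure_restrict (p : Fin 2 × Bool) :
    fedMeasure.restrict (Prod.snd ⁻¹' {p}) = Measure.map (fun θ : ℝ => (θ, p)) volume := by
  have hprod : (Prod.snd ⁻¹' {p} : Set FedLabel) = Set.univ ×ˢ {p} := by ext; simp
  rw [hprod, fedMeasure, ← Measure.prod_restrict, Measure.restrict_univ,
    Measure.restrict_singleton, Measure.count_singleton, one_smul, Measure.prod_dirac]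

lemma integral_fedMeasure {F : FedLabel → ℂ} (p : Fin 2 × Bool) (hF : ∀ ξ, ξ.2 ≠ p → F ξ = 0) :
    ∫ ξ, F ξ ∂fedMeasure = ∫ θ : ℝ, F (θ, p) := by
  rw [← (measurableEmbedding_prod_mk_right p).integral_map, ← fedMeasure_restrict]
  exact (setIntegral_eq_integral_of_forall_compl_eq_zero fun ξ hξ => hF ξ (by simpa using hξ)).symm

lemma memLp_component (s : Fin 2) (q : Bool) {h : ℝ → ℂ} (hh : MemLp h 2) :
    MemLp (component s q h) 2 fedMeasure := by
  have hindicator : component s q h =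
      (Prod.snd ⁻¹' {(s, q)} : Set FedLabel).indicator fun ξ => h ξ.1 := by
    funext ξ
    simp [component, Set.indicator]
  rw [hindicator, memLp_indicator_iff_restrict (measurable_snd (measurableSet_singleton _)),
    fedMeasure_restrict, (measurableEmbedding_prod_mk_right _).memLp_map_measure_iff]
  exact hh

lemma conj_component (h : ℝ → ℂ) (ξ : FedLabel) :
    conj (component s q h ξ) = component s q (fun θ => conj (h θ)) ξ := by
  simp only [component, apply_ite conj, map_zero]

lemma component_fedConj (h : ℝ → ℂ) (ξ : FedLabel) :
    component s q h (fedConj ξ) = component s (!q) h ξ := by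
  simp [component, fedConj, Prod.ext_iff, Bool.not_eq_eq_eq_not]

lemma component_mul_component (h h' : ℝ → ℂ) (ξ : FedLabel) :
    component s q h ξ * component s q h' ξ = component s q (fun θ => h θ * h' θ) ξ := by
  simp only [component]
  split_ifs <;> simp

lemma component_mul_component_of_ne (hne : (s, q) ≠ (s', q')) (h h' : ℝ → ℂ) (ξ : FedLabel) :
    component s q h ξ * component s' q' h' ξ = 0 := by
  by_cases hξ : ξ.2 = (s, q)
  · simp [component, hξ, hne]
  · simp [component, hξ]

lemma contraction_component (u : FedLabel → FedLabel → ℝ) (ρ : ℝ → ℂ) (η : Fin n → FedLabel) :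
    contraction fedMeasure u (component s q ρ) η = ∫ θ : ℝ, ρ θ *
      Circle.exp (phaseSum (Function.swap u) (θ, s, q) η - phaseSum u (θ, s, q) η) := by
  rw [contraction, integral_fedMeasure (s, q) fun ξ hξ => by simp [component, hξ]]
  simp [component]

lemma charge_not (q : Bool) : charge (!q) = -charge q := by
  cases q <;> simp [charge]

lemma measurePreserving_fedConj : MeasurePreserving fedConj fedMeasure fedMeasure := by
  have hinv : Function.Involutive fun p : Fin 2 × Bool => (p.1, !p.2) := fun p => by simp
  have hcount : MeasurePreserving (fun p : Fin 2 × Bool => (p.1, !p.2)) .count .count := by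
    refine ⟨.of_discrete, Measure.ext fun s hs => ?_⟩
    rw [Measure.map_apply .of_discrete hs, ← Measure.count_injective_image hinv.injective,
      Set.image_preimage_eq _ hinv.surjective]
  exact (MeasurePreserving.id volume).prod hcount

lemma measurablePhase_of_measurable {X : Type} [MeasurableSpace X] {u : X → X → ℝ}
    (hu : Measurable fun z : X × X => u z.1 z.2) : MeasurablePhase u :=
  (continuous_subtype_val.comp Circle.exp.continuous).measurable.comp hu

lemma measurable_charge_mul_charge (c : ℝ) :
    Measurable fun z : FedLabel × FedLabel => c * charge z.1.2.2 * charge z.2.2.2 := by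
  have hcharge : Measurable charge := .of_discrete
  fun_prop

lemma measurable_fedKernel (g : ℝ) :
    Measurable fun z : FedLabel × FedLabel => fedKernel g z.1 z.2 := by
  have hspecies : MeasurableSet {z : FedLabel × FedLabel | z.1.2.1 ≠ z.2.2.1} :=
    (measurableSet_eq_fun (by fun_prop) (by fun_prop)).compl
  have hbelow : MeasurableSet {z : FedLabel × FedLabel | z.2.1 < z.1.1} :=
    measurableSet_lt (by fun_prop) (by fun_prop)
  have hfirst : MeasurableSet {z : FedLabel × FedLabel | z.1.2.1 = 0} :=
    measurableSet_eq_fun (by fun_prop) (by fun_prop)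
  exact Measurable.ite (hspecies.inter hbelow)
    ((Measurable.ite hfirst measurable_const measurable_const).mul
      (measurable_charge_mul_charge _)) measurable_const

lemma measurable_fedScattering (g : ℝ) :
    Measurable fun z : FedLabel × FedLabel => fedScattering g z.1 z.2 := by
  have hspecies : MeasurableSet {z : FedLabel × FedLabel | z.1.2.1 = 0 ∧ z.2.2.1 = 1} :=
    (measurableSet_eq_fun (by fun_prop) (by fun_prop)).inter
      (measurableSet_eq_fun (by fun_prop) (by fun_prop))
  have hsign : Measurable Real.sign :=
    Measurable.ite measurableSet_Iio measurable_const
      (Measurable.ite measurableSet_Ioi measurable_const measurable_const)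
  exact Measurable.ite hspecies
    ((measurable_charge_mul_charge _).mul (hsign.comp (by fun_prop))) measurable_const

lemma fedScattering_add_fedScattering (g : ℝ) (ξ η : FedLabel) :
    fedScattering g ξ η + fedScattering g η ξ = fedKernel g ξ η + fedKernel g η ξ := by
  obtain ⟨a, s, q⟩ := ξ
  obtain ⟨b, s', q'⟩ := η
  rcases lt_trichotomy a b with h | rfl | h
  · fin_cases s <;> fin_cases s' <;>
      simp [fedScattering, fedKernel, h, h.not_gt, Real.sign_of_neg, Real.sign_of_pos]
    all_goals ring
  · simp [fedScattering, fedKernel]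
  · fin_cases s <;> fin_cases s' <;>
      simp [fedScattering, fedKernel, h, h.not_gt, Real.sign_of_neg, Real.sign_of_pos]
    all_goals ring

lemma compatiblePhases_fed (g : ℝ) :
    CompatiblePhases fedMeasure fedConj (fedKernel g) (fedScattering g) where
  involutive ξ := by simp [fedConj]
  measurePreserving := measurePreserving_fedConj
  diag ξ := by simp [fedKernel]
  pair := fedScattering_add_fedScattering g
  conj_phase ξ η := by
    simp only [fedKernel, fedConj, charge_not, mul_neg, neg_mul, neg_neg]
    rfl
  conj_scattering ξ η := by simp [fedScattering, fedConj, charge_not]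
  measurable_phase := measurablePhase_of_measurable (measurable_fedKernel g)
  measurable_scattering := measurablePhase_of_measurable (measurable_fedScattering g)

/-- The phase acquired when a particle `ξ` is moved past `η`. It depends on species and charges
only: the two-particle S-matrix of the Federbush model is constant. -/
def fedPhase (g : ℝ) (ξ η : FedLabel) : ℝ :=
  if ξ.2.1 ≠ η.2.1 then
    (if ξ.2.1 = 0 then 1 else -1) * (Real.pi * g * charge ξ.2.2 * charge η.2.2)
  else 0

lemma fedKernel_sub (g : ℝ) {ξ η : FedLabel} (h : ξ.1 ≠ η.1) :
    fedKernel g ξ η - fedKernel g η ξ = fedPhase g ξ η := by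
  obtain ⟨a, s, q⟩ := ξ
  obtain ⟨b, s', q'⟩ := η
  replace h : a ≠ b := h
  rcases lt_or_gt_of_ne h with h | h <;> fin_cases s <;> fin_cases s' <;>
    simp [fedKernel, fedPhase, h, h.not_gt]
  all_goals ring

lemma fedPhase_fedConj (g : ℝ) (ξ η : FedLabel) :
    fedPhase g (fedConj ξ) η = -fedPhase g ξ η := by
  simp only [fedPhase, fedConj, charge_not, mul_neg, neg_mul]
  rw [apply_ite (fun t : ℝ => -t), neg_zero]
  rfl

lemma phaseSum_fedKernel_sub (g : ℝ) {ξ : FedLabel} {η : Fin n → FedLabel}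
    (h : ∀ j, ξ.1 ≠ (η j).1) :
    phaseSum (fedKernel g) ξ η - phaseSum (Function.swap (fedKernel g)) ξ η =
      phaseSum (fedPhase g) ξ η := by
  simp only [phaseSum, ← Finset.sum_sub_distrib, Function.swap]
  exact Finset.sum_congr rfl fun j _ => fedKernel_sub g (h j)

lemma phaseSum_fedPhase_fedConj (g : ℝ) (ξ : FedLabel) (η : Fin n → FedLabel) :
    phaseSum (fedPhase g) (fedConj ξ) η = -phaseSum (fedPhase g) ξ η := by
  simp only [phaseSum, fedPhase_fedConj, Finset.sum_neg_distrib]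

lemma contraction_fed_crossing {m : ℝ} (hm : 0 < m) (g : ℝ) {f h : 𝓢(ℝ × ℝ, ℂ)}
    (hf : Function.support f ⊆ wedge) (hh : Function.support h ⊆ wedge) (s : Fin 2) (q : Bool)
    (η : Fin n → FedLabel) :
    contraction fedMeasure (Function.swap (fedKernel g))
        (component s (!q) fun θ => conj (waveFn m f θ) * waveFn m h (θ - Real.pi * I)) η =
      contraction fedMeasure (fedKernel g)
        (component s q fun θ => waveFn m h θ * conj (waveFn m f (θ - Real.pi * I))) η := by
  have hcrossing := integral_conj_waveFn_crossing hm hf hh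
    (H := fun _ => (Circle.exp (-phaseSum (fedPhase g) (0, s, q) η) : ℂ))
    continuousOn_const (differentiableOn_const _) (fun _ _ => le_rfl)
  have hne : ∀ᵐ θ : ℝ, ∀ j, θ ≠ (η j).1 := ae_forall_ne fun j => (η j).1
  rw [contraction_component, contraction_component]
  refine (integral_congr_ae ?_).trans (hcrossing.trans (integral_congr_ae ?_))
  · filter_upwards [hne] with θ hθ
    have hphase := phaseSum_fedPhase_fedConj g (θ, s, q) η
    rw [← phaseSum_fedKernel_sub g (by exact hθ)] at hphase
    exact congrArg (fun t => _ * (Circle.exp t : ℂ)) hphase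
  · filter_upwards [hne] with θ hθ
    have hphase := phaseSum_fedKernel_sub g (ξ := (θ, s, q)) hθ
    rw [← neg_sub (phaseSum (fedKernel g) _ _), hphase]
    rfl

lemma fedZ_eq_zField (m : Fin 2 → ℝ) (g : ℝ) (s : Fin 2) (q : Bool) (f : ℝ × ℝ → ℂ) :
    fedZ m g s q f = zField .fermi fedMeasure (fedKernel g)
      (component s q fun θ => waveFn (m s) f θ)
      (component s (!q) fun θ => waveFn (m s) f (θ - Real.pi * I)) := rfl

lemma fedZ_commuteOnFinite {m : Fin 2 → ℝ} (hm : ∀ s, 0 < m s) (g : ℝ) (s s' : Fin 2)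
    (q q' : Bool) {f h : 𝓢(ℝ × ℝ, ℂ)} (hf : Function.support f ⊆ wedge)
    (hh : Function.support h ⊆ wedge) :
    CommuteOnFinite .fermi fedMeasure (conjByJ (fedJ g) (fedZ m g s q f)) (fedZ m g s' q' h) := by
  rw [fedZ_eq_zField, fedZ_eq_zField]
  refine (compatiblePhases_fed g).commuteOnFinite_zField
    (memLp_component s q (memLp_waveFn (hm s).ne' f))
    (memLp_component s (!q) (memLp_waveFn_sub_pi (hm s).ne' f))
    (memLp_component s' q' (memLp_waveFn (hm s').ne' h))
    (memLp_component s' (!q') (memLp_waveFn_sub_pi (hm s').ne' h)) fun n η => ?_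
  simp only [component_fedConj, conj_component, Bool.not_not]
  by_cases hsq : (s, q) = (s', q')
  · obtain ⟨rfl, rfl⟩ := Prod.mk.inj hsq
    simp only [component_mul_component]
    exact contraction_fed_crossing (hm s) g hf hh s q η
  · have hsq' : (s, !q) ≠ (s', !q') := by simpa using hsq
    simp only [component_mul_component_of_ne hsq', component_mul_component_of_ne (Ne.symm hsq),
      contraction, zero_mul]

lemma fedZSharp_commuteOnFinite (g : ℝ) (hne : s ≠ s') {φ χ : FedLabel → ℂ}
    (hφ : MemLp φ 2 fedMeasure) (hχ : MemLp χ 2 fedMeasure) (hφs : ∀ ξ, ξ.2.1 ≠ s → φ ξ = 0)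
    (hχs : ∀ ξ, ξ.2.1 ≠ s' → χ ξ = 0) (b b' : Bool) :
    CommuteOnFinite .fermi fedMeasure
      (conjByJ (fedJ g) (zSharp .fermi fedMeasure (fedKernel g) b φ))
      (zSharp .fermi fedMeasure (fedKernel g) b' χ) := by
  refine (compatiblePhases_fed g).commuteOnFinite_zSharp hφ hχ (fun ξ => ?_) b b'
  by_cases hξ : ξ.2.1 = s
  · exact .inr (hχs ξ (hξ ▸ hne))
  · exact .inl (hφs (fedConj ξ) hξ)

lemma fedZ_isHermitianConj {m : Fin 2 → ℝ} (hm : ∀ s, m s ≠ 0) (g : ℝ) (s : Fin 2) (q : Bool)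
    (f : 𝓢(ℝ × ℝ, ℂ)) : IsHermitianConj .fermi fedMeasure (fedZ m g s q f)
      (fedZ m g s (!q) fun x => conj (f x)) := by
  have hconj := isHermitianConj_zField (σ := .fermi) (compatiblePhases_fed g).measurable_phase
    (memLp_component s q (memLp_waveFn (hm s) f))
    (memLp_component s (!q) (memLp_waveFn_sub_pi (hm s) f))
  rw [fedZ_eq_zField, fedZ_eq_zField, Bool.not_not]
  simp only [waveFn_conj_sub_pi]
  simpa only [waveFn_conj, Complex.conj_ofReal, conj_component] using hconj

end Federbush

end FWG

end

open FWG

theorem mainTheorem2 :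
    (∀ (m : ℝ) (ϑ : ℝ → ℝ) (S : ℂ → ℂ), 0 < m → IsTwoParticleS ϑ S →
      PreservesDomain .bose volume (scalarJ ϑ) ∧
      (∀ f : 𝓢(ℝ × ℝ, ℂ),
        PreservesDomain .bose volume (scalarZ m ϑ f) ∧
        IsHermitianConj .bose volume (scalarZ m ϑ f) (scalarZ m ϑ fun x => conj (f x))) ∧
      (∀ f g : 𝓢(ℝ × ℝ, ℂ), Function.support f ⊆ wedge → Function.support g ⊆ wedge →
        CommuteOnFinite .bose volume (conjByJ (scalarJ ϑ) (scalarZ m ϑ f)) (scalarZ m ϑ g)) ∧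
      (∀ f : 𝓢(ℝ × ℝ, ℂ), Function.support f ⊆ wedge →
        VecEq volume (scalarZ m ϑ f vacuum)
          (creation .bose (fun θ => waveFn m f (θ - Real.pi * Complex.I)) vacuum) ∧
        ((∀ x, (f x).im = 0) →
          VecEq volume (scalarZ m ϑ f vacuum)
            (creation .bose (fun θ => conj (waveFn m f θ)) vacuum)))) ∧
    (∀ (m : Fin 2 → ℝ) (g : ℝ), (∀ s, 0 < m s) →
      PreservesDomain .fermi fedMeasure (fedJ g) ∧
      (∀ (s : Fin 2) (q : Bool) (f : 𝓢(ℝ × ℝ, ℂ)),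
        PreservesDomain .fermi fedMeasure (fedZ m g s q f) ∧
        IsHermitianConj .fermi fedMeasure (fedZ m g s q f)
          (fedZ m g s (!q) fun x => conj (f x))) ∧
      (∀ (s s' : Fin 2) (b b' : Bool) (φ χ : FedLabel → ℂ), s ≠ s' →
        MemLp φ 2 fedMeasure → MemLp χ 2 fedMeasure →
        (∀ ξ, ξ.2.1 ≠ s → φ ξ = 0) → (∀ ξ, ξ.2.1 ≠ s' → χ ξ = 0) →
        CommuteOnFinite .fermi fedMeasure
          (conjByJ (fedJ g) (zSharp .fermi fedMeasure (fedKernel g) b φ))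
          (zSharp .fermi fedMeasure (fedKernel g) b' χ)) ∧
      (∀ (s s' : Fin 2) (q q' : Bool) (f h : 𝓢(ℝ × ℝ, ℂ)),
        Function.support f ⊆ wedge → Function.support h ⊆ wedge →
        CommuteOnFinite .fermi fedMeasure
          (conjByJ (fedJ g) (fedZ m g s q f)) (fedZ m g s' q' h))) := by
  refine ⟨fun m ϑ S hm hS => ?_, fun m g hm => ?_⟩
  · have hP := hS.compatiblePhases
    have hann (f : 𝓢(ℝ × ℝ, ℂ)) := memLp_waveFn hm.ne' f
    have hcre (f : 𝓢(ℝ × ℝ, ℂ)) := memLp_waveFn_sub_pi hm.ne' f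
    refine ⟨preservesDomain_modularJ hP.measurePreserving hP.measurable_scattering,
      fun f => ⟨preservesDomain_zField hP.measurable_phase (hann f) (hcre f),
        hS.isHermitianConj_scalarZ hm.ne' f⟩,
      fun f g hf hg => hP.commuteOnFinite_zField (hann f) (hcre f) (hann g) (hcre g)
        fun n η => hS.contraction_crossing hm hf hg η,
      fun f _ => ⟨fun n => by rw [scalarZ_vacuum], fun hreal n => ?_⟩⟩
    simp only [scalarZ_vacuum, waveFn_sub_pi_of_real m hreal]
    rfl
  · have hP := compatiblePhases_fed g
    exact ⟨preservesDomain_modularJ hP.measurePreserving hP.measurable_scattering,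
      fun s q f => ⟨preservesDomain_zField hP.measurable_phase
          (memLp_component s q (memLp_waveFn (hm s).ne' f))
          (memLp_component s (!q) (memLp_waveFn_sub_pi (hm s).ne' f)),
        fedZ_isHermitianConj (fun s => (hm s).ne') g s q f⟩,
      fun s s' b b' φ χ hne hφ hχ hφs hχs =>
        fedZSharp_commuteOnFinite g hne hφ hχ hφs hχs b b',
      fun s s' q q' f h hf hh => fedZ_commuteOnFinite hm g s s' q q' hf hh⟩
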